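/- Let $1\le d\le n$ and let $f\in\mathbb R[x]=\mathbb R[x_1,\dots,x_n]$ be homogeneous of degree $d$ and stable, i.e. $f(\mu)\neq 0$ for every $\mu\in\mathbb C^n$ all of whose coordinates have positive imaginary part; assume the sign normalization that $f$ is positive at some (equivalently, every) point of the open positive orthant $\mathbb R_{>0}^n$. Suppose that $f$ is affine in $x_1,\dots,x_d$, i.e. of degree at most one in each of these variables, and that the coefficient of the monomial $x_1\cdots x_d$ in $f$ is nonzero. Then the following are equivalent: (1) for all $1\le i,j\le d$, the polynomial $$\Delta_{ij}f=\frac{\partial f}{\partial x_i}\cdot\frac{\partial f}{\partial x_j}-f\cdot\frac{\partial^2 f}{\partial x_i\,\partial x_j}$$ is a square in $\mathbb R[x]$; (2) for all $1\le i,j\le d$, the class of $\frac{\partial f}{\partial x_i}\cdot\frac{\partial f}{\partial x_j}$ is a square in $\mathbb R[x]/(f)$; (3) $f$ has a definite determinantal representation, i.e. there are real symmetric $d\times d$ matrices $M_1,\dots,M_n$ with $f=\det(x_1M_1+\dots+x_nM_n)$ such that $e_1M_1+\dots+e_nM_n$ is positive definite for some $e\in\mathbb R^n$. -/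

import Mathlib

open MvPolynomial

/-- A complex polynomial is stable if it does not vanish at any point all of whose coordinates have
positive imaginary part. -/
def IsStable {n : ℕ} (F : MvPolynomial (Fin n) ℂ) : Prop :=
  ∀ μ : Fin n → ℂ, (∀ i, 0 < (μ i).im) → eval μ F ≠ 0

/-- `f` is affine in the variable `x_i`: its degree in `x_i` is at most one. -/
def IsAffineIn {n : ℕ} (f : MvPolynomial (Fin n) ℝ) (i : Fin n) : Prop :=
  degreeOf i f ≤ 1

/-- `Δ_ij f = ∂f/∂x_i · ∂f/∂x_j - f · ∂²f/∂x_i∂x_j`. -/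
noncomputable def wronskianDelta {n : ℕ} (i j : Fin n) (f : MvPolynomial (Fin n) ℝ) :
    MvPolynomial (Fin n) ℝ :=
  pderiv i f * pderiv j f - f * pderiv i (pderiv j f)

/-- The matrix of linear forms `M(x) = ∑ i, x_i M_i`. -/
noncomputable def linearPencil {n d : ℕ} (M : Fin n → Matrix (Fin d) (Fin d) ℝ) :
    Matrix (Fin d) (Fin d) (MvPolynomial (Fin n) ℝ) :=
  ∑ i, (X i : MvPolynomial (Fin n) ℝ) • (M i).map C

/-- A definite determinantal representation of a form `f` of degree `d`: real symmetric `d × d`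
matrices `M_1, …, M_n` with `f = det (∑ i, x_i M_i)` such that `∑ i, e_i M_i` is positive definite
for some real point `e`. -/
def HasDefiniteDetRep {n : ℕ} (d : ℕ) (f : MvPolynomial (Fin n) ℝ) : Prop :=
  ∃ M : Fin n → Matrix (Fin d) (Fin d) ℝ,
    (∀ i, (M i).IsSymm) ∧
    (∃ e : Fin n → ℝ, (∑ i, e i • M i).PosDef) ∧
    f = (linearPencil M).det

/-! Write ∂_i f for the partials in the affine variables. (1) and (2) differ only by eliminating x_i
modulo f, since f is linear in x_i with leading coefficient ∂_i f. The basic tool is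
`eq_zero_of_dvd_of_pderiv_eq_zero`: a congruence modulo f between polynomials free of x_i is an
equality.

For (3) ⇒ (1), let L be the pencil with f = det L. Affineness in x_i, tested on a line through a
definite point, forces M_i to have rank at most one, so M_i = a v vᵀ and M_j = b w wᵀ.
Differentiating the adjugate gives Δ_ij f = ab (vᵀ adj(L) w)² (`wronskianDelta_det_linearPencil`). A
negative ab is compatible with stability only if Δ_ij f = 0, because Laguerre's inequality makes
Δ_ij f nonnegative wherever ∂_i∂_j f ≠ 0.

For (1) ⇒ (3), the roots of Δ_ij f should be the entries of a matrix G = f L⁻¹ with ∂_a L the a-th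
diagonal matrix unit. Such a G satisfies f ∂_k G_ij = G_ij ∂_k f - G_ik G_kj, and
`exists_signed_roots` chooses signs that make these equations hold. The pencil L is then read off
from the first-order jet of G at u = ∑ e_a, where f(u) = c is the coefficient of x_1⋯x_d and G(u) =
c·1. The errors LG - f·1 and f - c det L solve linear systems that become regular singular ODEs on
every line through u, and they vanish at u to an order beyond the exponent; hence they are zero.
Stability and the sign normalization give c > 0, so a d-th root of c can be absorbed into L. -/

/-! ### Partial derivatives and degrees in a single variable. -/

section PartialDerivatives

variable {σ : Type*}

theorem pderiv_comm (i j : σ) (p : MvPolynomial σ ℝ) :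
    pderiv i (pderiv j p) = pderiv j (pderiv i p) := by
  classical
  ext m
  simp only [coeff_pderiv, Finsupp.add_apply]
  rcases eq_or_ne i j with rfl | h
  · rfl
  · rw [Finsupp.single_eq_of_ne h, Finsupp.single_eq_of_ne h.symm, add_right_comm]
    push_cast
    ring

theorem degreeOf_eq_zero_of_pderiv_eq_zero {i : σ} {p : MvPolynomial σ ℝ} (h : pderiv i p = 0) :
    degreeOf i p = 0 := by
  classical
  rw [← Nat.le_zero, degreeOf_le_iff]
  intro m hm
  by_contra hmi
  have h1 : Finsupp.single i 1 ≤ m := by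
    rw [Finsupp.single_le_iff]; lia
  have h2 := coeff_pderiv (i := i) p (m - Finsupp.single i 1)
  rw [h, tsub_add_cancel_of_le h1, coeff_zero, eq_comm, mul_eq_zero] at h2
  rcases h2 with h2 | h2
  · exact (mem_support_iff.mp hm) h2
  · exact (Nat.cast_add_one_pos (α := ℝ) _).ne' h2

theorem pderiv_pderiv_self_eq_zero {i : σ} {p : MvPolynomial σ ℝ} (h : degreeOf i p ≤ 1) :
    pderiv i (pderiv i p) = 0 := by
  classical
  ext m
  rw [coeff_pderiv, coeff_pderiv, coeff_zero]
  have : coeff (m + Finsupp.single i 1 + Finsupp.single i 1) p = 0 := by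
    by_contra hc
    have := degreeOf_le_iff.mp h _ (mem_support_iff.mpr hc)
    simp at this
  rw [this]
  simp

theorem degreeOf_pderiv_le (k i : σ) (p : MvPolynomial σ ℝ) :
    degreeOf k (pderiv i p) ≤ degreeOf k p := by
  classical
  rw [degreeOf_le_iff]
  intro m hm
  rw [mem_support_iff, coeff_pderiv] at hm
  exact le_trans (by simp) (monomial_le_degreeOf k (mem_support_iff.mpr (left_ne_zero_of_mul hm)))

/-- A polynomial free of a variable cannot be a nonzero multiple of one involving it. -/
theorem eq_zero_of_dvd_of_pderiv_eq_zero {b : σ} {f p : MvPolynomial σ ℝ}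
    (hf : pderiv b f ≠ 0) (hdvd : f ∣ p) (hp : pderiv b p = 0) : p = 0 := by
  obtain ⟨q, rfl⟩ := hdvd
  by_contra h
  have h1 := degreeOf_eq_zero_of_pderiv_eq_zero hp
  rw [degreeOf_mul_eq (left_ne_zero_of_mul h) (right_ne_zero_of_mul h)] at h1
  refine hf (pderiv_eq_zero_of_notMem_vars fun hv => ?_)
  exact mem_vars_iff_degreeOf_ne_zero.mp hv (by lia)

end PartialDerivatives

/-! ### Restriction to real lines. -/

section LineRestriction

variable {σ : Type*}

/-- Restriction of a polynomial to the line `t ↦ x + t v`. -/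
noncomputable def lineRestrict (x v : σ → ℝ) : MvPolynomial σ ℝ →ₐ[ℝ] Polynomial ℝ :=
  aeval fun k => Polynomial.C (x k) + Polynomial.C (v k) * Polynomial.X

theorem lineRestrict_X (x v : σ → ℝ) (k : σ) :
    lineRestrict x v (X k) = Polynomial.C (x k) + Polynomial.C (v k) * Polynomial.X := by
  simp [lineRestrict]

theorem eval_lineRestrict (x v : σ → ℝ) (t : ℝ) (p : MvPolynomial σ ℝ) :
    (lineRestrict x v p).eval t = eval (fun k => x k + t * v k) p := by
  induction p using MvPolynomial.induction_on with
  | C a => simp [lineRestrict]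
  | add p q hp hq => simp [hp, hq]
  | mul_X p k hp => simp [hp, lineRestrict_X, mul_comm t]

theorem derivative_lineRestrict [Fintype σ] (x v : σ → ℝ) (p : MvPolynomial σ ℝ) :
    Polynomial.derivative (lineRestrict x v p) =
      ∑ k, Polynomial.C (v k) * lineRestrict x v (pderiv k p) := by
  classical
  induction p using MvPolynomial.induction_on with
  | C a => simp [lineRestrict]
  | add p q hp hq => simp [hp, hq, mul_add, Finset.sum_add_distrib]
  | mul_X p k hp =>
    have hk : ∑ j, Polynomial.C (v j) * lineRestrict x v (p * pderiv j (X k)) =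
        lineRestrict x v p * Polynomial.C (v k) := by
      rw [Finset.sum_eq_single k]
      · rw [pderiv_X_self, mul_one, mul_comm]
      · intro j _ hj
        rw [pderiv_X_of_ne hj.symm, mul_zero, map_zero, mul_zero]
      · simp
    have hX : Polynomial.derivative (lineRestrict x v (X k)) = Polynomial.C (v k) := by
      simp [lineRestrict_X]
    rw [map_mul, Polynomial.derivative_mul, hp, hX, ← hk, Finset.sum_mul, ← Finset.sum_add_distrib]
    refine Finset.sum_congr rfl fun j _ => ?_
    simp only [pderiv_mul, map_add, map_mul]
    ring

theorem eval_zero_lineRestrict (x v : σ → ℝ) (p : MvPolynomial σ ℝ) :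
    (lineRestrict x v p).eval 0 = eval x p := by
  simp [eval_lineRestrict]

theorem eval_add_single [Fintype σ] [DecidableEq σ] {i : σ} {p : MvPolynomial σ ℝ}
    (hp : pderiv i (pderiv i p) = 0) (x : σ → ℝ) (t : ℝ) :
    eval (x + t • Pi.single i 1) p = eval x p + t * eval x (pderiv i p) := by
  have hder : ∀ q : MvPolynomial σ ℝ, Polynomial.derivative (lineRestrict x (Pi.single i 1) q) =
      lineRestrict x (Pi.single i 1) (pderiv i q) := by
    intro q
    rw [derivative_lineRestrict, Finset.sum_eq_single i]
    · simp
    · intro j _ hj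
      simp [Pi.single_eq_of_ne hj]
    · simp
  have hconst : ∀ q : MvPolynomial σ ℝ, pderiv i q = 0 →
      lineRestrict x (Pi.single i 1) q = Polynomial.C (eval x q) := by
    intro q hq
    have h1 := Polynomial.derivative_eq_zero
      (p := lineRestrict x (Pi.single i 1) q) |>.mp (by rw [hder, hq, map_zero])
    rw [Polynomial.eq_C_of_natDegree_eq_zero h1, Polynomial.coeff_zero_eq_eval_zero,
      eval_zero_lineRestrict]
  -- Subtracting the expected linear term leaves zero derivative, hence a constant.
  have h2 := Polynomial.derivative_eq_zero
    (p := lineRestrict x (Pi.single i 1) p - Polynomial.C (eval x (pderiv i p)) * Polynomial.X) |>.mp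
    (by simp [hder, hconst _ hp])
  have h3 := Polynomial.eq_C_of_natDegree_eq_zero h2
  rw [Polynomial.coeff_zero_eq_eval_zero] at h3
  have h4 := congrArg (Polynomial.eval t) h3
  simp only [Polynomial.eval_sub, eval_lineRestrict, Polynomial.eval_mul, Polynomial.eval_C,
    Polynomial.eval_X] at h4
  have h5 : (x + t • Pi.single i 1 : σ → ℝ) = fun k => x k + t * (Pi.single i 1 : σ → ℝ) k := by
    ext; simp
  rw [h5]
  simp only [zero_mul, mul_zero, add_zero, sub_zero] at h4
  linarith

end LineRestriction

/-! ### Derivations of determinants. -/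

section Jacobi

variable {A : Type*} [CommRing A] [Algebra ℝ A]

theorem Derivation.leibniz_finset_prod {ι : Type*} [DecidableEq ι] (D : Derivation ℝ A A)
    (s : Finset ι) (f : ι → A) :
    D (∏ i ∈ s, f i) = ∑ i ∈ s, (∏ j ∈ s.erase i, f j) * D (f i) := by
  induction s using Finset.induction_on with
  | empty => simp
  | insert a s ha ih =>
    rw [Finset.prod_insert ha, D.leibniz, ih, Finset.sum_insert ha, Finset.erase_insert ha]
    simp only [smul_eq_mul, Finset.mul_sum]
    rw [add_comm]
    congr 1
    refine Finset.sum_congr rfl fun i hi => ?_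
    have : i ≠ a := fun h => ha (h ▸ hi)
    rw [Finset.erase_insert_of_ne this.symm, Finset.prod_insert (by simp [ha]), mul_assoc]

/-- Jacobi's formula for the derivative of a determinant. -/
theorem Derivation.det_eq_trace {ι : Type*} [Fintype ι] [DecidableEq ι] (D : Derivation ℝ A A)
    (M : Matrix ι ι A) : D M.det = (M.adjugate * M.map D).trace := by
  have h1 : D M.det = ∑ i, (M.updateCol i fun k => D (M k i)).det := by
    simp only [Matrix.det_apply', map_sum]
    rw [Finset.sum_comm]
    refine Finset.sum_congr rfl fun s _ => ?_
    rw [D.leibniz, D.map_intCast, smul_zero, add_zero, smul_eq_mul, D.leibniz_finset_prod,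
      Finset.mul_sum]
    refine Finset.sum_congr rfl fun i _ => ?_
    rw [← Finset.prod_erase_mul _ _ (Finset.mem_univ i), Matrix.updateCol_self]
    congr 2
    exact Finset.prod_congr rfl fun j hj => (Matrix.updateCol_ne (Finset.ne_of_mem_erase hj)).symm
  rw [h1, Matrix.trace]
  refine Finset.sum_congr rfl fun i _ => ?_
  rw [← Matrix.cramer_apply, Matrix.cramer_eq_adjugate_mulVec]
  rfl

end Jacobi

/-! ### From squares modulo f to squares of polynomials. -/

section QuotientSquares

variable {n : ℕ}

/-- With f = x_i A + B and A, B free of x_i, one has A x_i ≡ -B modulo f, so each factor x_i can be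
traded for one factor A. -/
theorem exists_pow_mul_congr_of_pderiv_eq_zero {i : Fin n} {f : MvPolynomial (Fin n) ℝ}
    (hf : pderiv i (pderiv i f) = 0) (h : MvPolynomial (Fin n) ℝ) :
    ∃ (N : ℕ) (h' : MvPolynomial (Fin n) ℝ),
      pderiv i h' = 0 ∧ f ∣ pderiv i f ^ N * h - h' := by
  induction h using MvPolynomial.induction_on with
  | C a => exact ⟨0, C a, by simp, by simp⟩
  | add p q hp hq =>
    obtain ⟨N, p', hp0, u, hu⟩ := hp
    obtain ⟨K, q', hq0, w, hw⟩ := hq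
    refine ⟨N + K, pderiv i f ^ K * p' + pderiv i f ^ N * q', ?_, ?_⟩
    · simp [hf, hp0, hq0]
    · exact ⟨pderiv i f ^ K * u + pderiv i f ^ N * w, by
        linear_combination pderiv i f ^ K * hu + pderiv i f ^ N * hw⟩
  | mul_X p k hp =>
    obtain ⟨N, p', hp0, u, hu⟩ := hp
    rcases eq_or_ne k i with rfl | hk
    · refine ⟨N + 1, p' * (X k * pderiv k f - f), ?_, ?_⟩
      · simp [hf, hp0]
      · exact ⟨u * (X k * pderiv k f) + p', by
          linear_combination (X k * pderiv k f) * hu⟩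
    · exact ⟨N, p' * X k, by simp [hp0, pderiv_X_of_ne hk], u * X k, by
        linear_combination X k * hu⟩

theorem pderiv_wronskianDelta_left {i : Fin n} (j : Fin n) {f : MvPolynomial (Fin n) ℝ}
    (hf : pderiv i (pderiv i f) = 0) : pderiv i (wronskianDelta i j f) = 0 := by
  have h : pderiv i (pderiv i (pderiv j f)) = 0 := by
    rw [pderiv_comm i j, pderiv_comm i j, hf, map_zero]
  simp only [wronskianDelta, map_sub, pderiv_mul, hf, h]
  ring

theorem isSquare_wronskianDelta_of_isSquare_mk {i j : Fin n} {f : MvPolynomial (Fin n) ℝ}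
    (hf : pderiv i (pderiv i f) = 0) (hne : pderiv i f ≠ 0)
    (h : IsSquare (Ideal.Quotient.mk (Ideal.span {f}) (pderiv i f * pderiv j f))) :
    IsSquare (wronskianDelta i j f) := by
  obtain ⟨r, hr⟩ := h
  obtain ⟨g, rfl⟩ := Ideal.Quotient.mk_surjective r
  rw [← map_mul, Ideal.Quotient.eq, Ideal.mem_span_singleton] at hr
  obtain ⟨u, hu⟩ := hr
  obtain ⟨N, g', hg', w, hw⟩ := exists_pow_mul_congr_of_pderiv_eq_zero hf g
  -- Both terms are free of x_i, so their congruence modulo f is an equality.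
  have hzero : pderiv i f ^ (2 * N) * wronskianDelta i j f - g' ^ 2 = 0 := by
    refine eq_zero_of_dvd_of_pderiv_eq_zero hne (b := i) (f := f)
      ⟨pderiv i f ^ (2 * N) * (u - pderiv i (pderiv j f)) + w * (pderiv i f ^ N * g + g'), ?_⟩ ?_
    · rw [wronskianDelta]
      linear_combination pderiv i f ^ (2 * N) * hu + (pderiv i f ^ N * g + g') * hw
    · simp [hf, hg', pderiv_wronskianDelta_left j hf]
  have hdvd : (pderiv i f ^ N) ^ 2 ∣ g' ^ 2 :=
    ⟨wronskianDelta i j f, by rw [← sub_eq_zero.mp hzero, ← pow_mul, mul_comm N]⟩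
  -- Polynomial rings over a field are integrally closed, so divisibility of squares descends to the
  -- roots.
  obtain ⟨q, hq⟩ := (IsIntegrallyClosed.pow_dvd_pow_iff two_ne_zero).mp hdvd
  refine ⟨q, mul_left_cancel₀ (pow_ne_zero (2 * N) hne) ?_⟩
  rw [sub_eq_zero.mp hzero, hq]
  ring

end QuotientSquares

/-! ### Consistent signs for the square roots of Δ_ij f. -/

section SignedRoots

variable {n : ℕ} {ι : Type*}

theorem degreeOf_wronskianDelta_le {i j k : Fin n} {f : MvPolynomial (Fin n) ℝ}
    (hf : degreeOf k f ≤ 1) : degreeOf k (wronskianDelta i j f) ≤ 2 := by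
  have h1 := (degreeOf_pderiv_le k i f).trans hf
  have h2 := (degreeOf_pderiv_le k j f).trans hf
  have h3 := (degreeOf_pderiv_le k i (pderiv j f)).trans h2
  refine (degreeOf_sub_le _ _ _).trans (max_le ?_ ?_)
  · exact (degreeOf_mul_le _ _ _).trans (by lia)
  · exact (degreeOf_mul_le _ _ _).trans (by lia)

theorem degreeOf_le_one_of_sq {k : Fin n} {g p : MvPolynomial (Fin n) ℝ} (h : g ^ 2 = p)
    (hp : degreeOf k p ≤ 2) : degreeOf k g ≤ 1 := by
  rcases eq_or_ne g 0 with rfl | hg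
  · simp
  · rw [← h, degreeOf_pow_eq _ _ _ hg] at hp
    lia

theorem pderiv_eq_zero_of_sq {k : Fin n} {g p : MvPolynomial (Fin n) ℝ} (h : g ^ 2 = p)
    (hp : pderiv k p = 0) : pderiv k g = 0 := by
  rw [← h, pderiv_pow] at hp
  simp only [mul_eq_zero] at hp
  rcases hp with (hp | hp) | hp
  · exact absurd hp (by norm_num)
  · rw [show g = 0 by simpa using hp, map_zero]
  · exact hp

theorem wronskianDelta_comm (i j : Fin n) (f : MvPolynomial (Fin n) ℝ) :
    wronskianDelta i j f = wronskianDelta j i f := by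
  rw [wronskianDelta, wronskianDelta, pderiv_comm i j, mul_comm (pderiv i f)]

theorem exists_symmetric_roots [LinearOrder ι] (v : ι → Fin n) {f : MvPolynomial (Fin n) ℝ}
    (haff : ∀ i, degreeOf (v i) f ≤ 1)
    (hsq : ∀ i j, IsSquare (wronskianDelta (v i) (v j) f)) :
    ∃ g : ι → ι → MvPolynomial (Fin n) ℝ, (∀ i, g i i = pderiv (v i) f) ∧
      (∀ i j, g i j = g j i) ∧ ∀ i j, g i j ^ 2 = wronskianDelta (v i) (v j) f := by
  choose r hr using hsq
  refine ⟨fun i j => if i = j then pderiv (v i) f else r (min i j) (max i j), ?_, ?_, ?_⟩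
  · simp
  · intro i j
    rcases eq_or_ne i j with rfl | h
    · rfl
    · simp [h, h.symm, min_comm, max_comm]
  · intro i j
    rcases eq_or_ne i j with rfl | h
    · simp [wronskianDelta, pderiv_pderiv_self_eq_zero (haff i), sq]
    · simp only [h, if_false]
      rcases le_total i j with h1 | h1
      · rw [min_eq_left h1, max_eq_right h1, hr, sq]
      · rw [min_eq_right h1, max_eq_left h1, wronskianDelta_comm, hr, sq]

/-- If all `Δ_ij f` are squares, their roots can be given consistent signs, so that the matrix of
roots satisfies the differential equations of `f` times the inverse of a linear pencil. -/
theorem exists_signed_roots [LinearOrder ι] (v : ι → Fin n) {f : MvPolynomial (Fin n) ℝ}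
    (haff : ∀ i, degreeOf (v i) f ≤ 1) (hne : ∀ i, pderiv (v i) f ≠ 0)
    (hsq : ∀ i j, IsSquare (wronskianDelta (v i) (v j) f)) :
    ∃ G : Matrix ι ι (MvPolynomial (Fin n) ℝ), (∀ i, G i i = pderiv (v i) f) ∧
      (∀ i j, G i j = G j i) ∧ (∀ i j, G i j ^ 2 = wronskianDelta (v i) (v j) f) ∧
      ∀ i j k, f * pderiv (v k) (G i j) = G i j * pderiv (v k) f - G i k * G k j := by
  obtain ⟨g, gdiag, gsymm, gsq⟩ := exists_symmetric_roots v haff hsq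
  have hD2 : ∀ k, pderiv (v k) (pderiv (v k) f) = 0 := fun k => pderiv_pderiv_self_eq_zero (haff k)
  have hl : ∀ i j, pderiv (v i) (g i j) = 0 := fun i j =>
    pderiv_eq_zero_of_sq (gsq i j) (pderiv_wronskianDelta_left _ (hD2 i))
  have hr : ∀ i j, pderiv (v j) (g i j) = 0 := fun i j => by rw [gsymm, hl]
  have hg2 : ∀ i j k, pderiv (v k) (pderiv (v k) (g i j)) = 0 := fun i j k =>
    pderiv_pderiv_self_eq_zero
      (degreeOf_le_one_of_sq (gsq i j) (degreeOf_wronskianDelta_le (haff k)))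
  have hdiag : ∀ i, g i i ≠ 0 := fun i => by rw [gdiag]; exact hne i
  -- The squares of both sides are congruent modulo f to (∂_k f)² ∂_i f ∂_j f, and both are free of
  -- x_k; so they agree, and only a sign is open.
  have hW : ∀ i j k,
      pderiv (v k) f * g i j - f * pderiv (v k) (g i j) = g i k * g k j ∨
      pderiv (v k) f * g i j - f * pderiv (v k) (g i j) = -(g i k * g k j) := by
    intro i j k
    rw [← sq_eq_sq_iff_eq_or_eq_neg, ← sub_eq_zero]
    refine eq_zero_of_dvd_of_pderiv_eq_zero (hne k) (b := v k)
      ⟨-(pderiv (v k) f) ^ 2 * pderiv (v i) (pderiv (v j) f)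
        - 2 * pderiv (v k) f * g i j * pderiv (v k) (g i j) + f * (pderiv (v k) (g i j)) ^ 2
        + pderiv (v i) f * pderiv (v k) f * pderiv (v k) (pderiv (v j) f)
        + pderiv (v k) f * pderiv (v j) f * pderiv (v i) (pderiv (v k) f)
        - f * pderiv (v i) (pderiv (v k) f) * pderiv (v k) (pderiv (v j) f), ?_⟩ ?_
    · have h1 := gsq i j
      have h2 := gsq i k
      have h3 := gsq k j
      simp only [wronskianDelta] at h1 h2 h3
      linear_combination pderiv (v k) f ^ 2 * h1 - g k j ^ 2 * h2 -
        (pderiv (v i) f * pderiv (v k) f - f * pderiv (v i) (pderiv (v k) f)) * h3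
    · simp only [map_sub, pderiv_mul, pderiv_pow, hD2, hr, hl, hg2]
      ring
  -- Transitivity is `hW` with the middle index differentiated. The classes are the blocks of G; a
  -- representative b of each class will fix the signs inside it.
  let s : Setoid ι :=
    { r := fun i j => g i j ≠ 0
      iseqv := by
        refine ⟨hdiag, fun {i j} h => by rwa [gsymm], fun {i j k} h1 h2 h3 => ?_⟩
        have := hW i k j
        rw [h3] at this
        simp [h1, h2] at this }
  let b : ι → ι := fun i => (Quotient.mk s i).out
  have hb : ∀ i, g i (b i) ≠ 0 := fun i => by
    rw [gsymm]
    exact Quotient.exact (s := s) (Quotient.out_eq (Quotient.mk s i))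
  have hb' : ∀ i j, g i j ≠ 0 → b i = b j := fun i j h =>
    congrArg Quotient.out (Quotient.sound (s := s) h)
  -- The sign is chosen so that the identity holds with a plus sign for k = b(i).
  have hG : ∀ i j, ∃ G, (G = g i j ∨ G = -g i j) ∧
      pderiv (v (b i)) f * G - f * pderiv (v (b i)) G = g i (b i) * g (b i) j := by
    intro i j
    rcases hW i j (b i) with h | h
    · exact ⟨g i j, Or.inl rfl, h⟩
    · exact ⟨-g i j, Or.inr rfl, by rw [map_neg]; linear_combination -h⟩
  choose G hGg hGb using hG
  have hGsq : ∀ i j, G i j ^ 2 = g i j ^ 2 := fun i j => by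
    rcases hGg i j with h | h <;> rw [h]
    ring
  have hG0 : ∀ i j, g i j = 0 → G i j = 0 := fun i j h => by
    rcases hGg i j with h' | h' <;> simp [h', h]
  -- The sign is forced when the root is nonzero; the diagonal and the symmetry of G follow from
  -- this uniqueness.
  have key : ∀ i j (H : MvPolynomial (Fin n) ℝ), g i j ≠ 0 → (H = G i j ∨ H = -G i j) →
      pderiv (v (b i)) f * H - f * pderiv (v (b i)) H = g i (b i) * g (b i) j → H = G i j := by
    intro i j H hij hH h
    rcases hH with hH | hH
    · exact hH
    · rw [hH, map_neg] at h
      have h1 : (2 : MvPolynomial (Fin n) ℝ) * (g i (b i) * g (b i) j) = 0 := by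
        linear_combination -h - hGb i j
      have h2 : g (b i) j ≠ 0 := by rw [hb' i j hij, gsymm]; exact hb j
      simp [hb i, h2] at h1
  refine ⟨G, ?_, ?_, fun i j => by rw [hGsq, gsq], ?_⟩
  · intro i
    rw [← gdiag]
    refine (key i i _ (hdiag i) ?_ ?_).symm
    · rcases hGg i i with h | h <;> simp [h]
    · have h1 := gsq i (b i)
      rw [wronskianDelta, pderiv_comm] at h1
      rw [gdiag, gsymm (b i) i]
      linear_combination -h1
  · intro i j
    by_cases hij : g i j = 0
    · rw [hG0 i j hij, hG0 j i (by rw [gsymm, hij])]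
    · refine (key i j _ hij ?_ ?_).symm
      · rcases hGg i j with h | h <;> rcases hGg j i with h' | h' <;> simp [h, h', gsymm j i]
      · have h1 := hGb j i
        rw [← hb' i j hij] at h1
        rw [h1, gsymm j, gsymm _ i, mul_comm]
  · intro i j k
    have hpm : pderiv (v k) f * G i j - f * pderiv (v k) (G i j) = G i k * G k j ∨
        pderiv (v k) f * G i j - f * pderiv (v k) (G i j) = -(G i k * G k j) := by
      rw [← sq_eq_sq_iff_eq_or_eq_neg, mul_pow, hGsq, hGsq, ← mul_pow]
      have h2 : (pderiv (v k) f * G i j - f * pderiv (v k) (G i j)) ^ 2 =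
          (pderiv (v k) f * g i j - f * pderiv (v k) (g i j)) ^ 2 := by
        rcases hGg i j with h | h <;> rw [h]
        rw [map_neg]
        ring
      rw [h2, sq_eq_sq_iff_eq_or_eq_neg]
      exact hW i j k
    rcases hpm with h | h
    · linear_combination -h
    · by_cases hik : g i k = 0
      · rw [hG0 i k hik] at h ⊢
        linear_combination -h
      by_cases hkj : g k j = 0
      · rw [hG0 k j hkj] at h ⊢
        linear_combination -h
      -- Suppose the minus sign occurs with i, j, k in one block. Multiplying by (∂_b f)² and
      -- reducing modulo f by the normalized identities at b = b(k) leaves 2 g_ib g_bj g_bk² ≡ 0.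
      -- This is free of x_b, hence zero, although no factor is.
      exfalso
      have hbk : b i = b k := hb' i k hik
      have hbj : b k = b j := hb' k j hkj
      have e1 := hGb i j
      have e2 := hGb i k
      have e3 := hGb k j
      have e4 := gsq (b k) k
      rw [wronskianDelta] at e4
      rw [hbk] at e1 e2
      have hfree : g i (b k) * g (b k) j * g (b k) k ^ 2 = 0 := by
        have h2 : (2 : MvPolynomial (Fin n) ℝ) * (g i (b k) * g (b k) j * g (b k) k ^ 2) = 0 := by
          set B := pderiv (v (b k)) f
          refine eq_zero_of_dvd_of_pderiv_eq_zero (hne (b k)) (b := v (b k)) ?_ ?_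
          · have c1 : f ∣ B * G i j - g i (b k) * g (b k) j := ⟨pderiv (v (b k)) (G i j), by linear_combination e1⟩
            have c2 : f ∣ B * G i k - g i (b k) * g (b k) k := ⟨pderiv (v (b k)) (G i k), by linear_combination e2⟩
            have c3 : f ∣ B * G k j - g k (b k) * g (b k) j := ⟨pderiv (v (b k)) (G k j), by linear_combination e3⟩
            have c4 : f ∣ B * pderiv (v k) f - g (b k) k ^ 2 := 
              ⟨pderiv (v (b k)) (pderiv (v k) f), by linear_combination -e4⟩
            have c5 : f ∣ pderiv (v k) f * G i j + G i k * G k j := 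
              ⟨pderiv (v k) (G i j), by linear_combination h⟩
            rw [gsymm k] at c3
            have : (2 : MvPolynomial (Fin n) ℝ) * (g i (b k) * g (b k) j * g (b k) k ^ 2) =
                B ^ 2 * (pderiv (v k) f * G i j + G i k * G k j)
                - (B * pderiv (v k) f) * (B * G i j - g i (b k) * g (b k) j)
                - (g i (b k) * g (b k) j) * (B * pderiv (v k) f - g (b k) k ^ 2)
                - (B * G k j) * (B * G i k - g i (b k) * g (b k) k)
                - (g i (b k) * g (b k) k) * (B * G k j - g (b k) k * g (b k) j) := by ring
            rw [this]
            exact dvd_sub (dvd_sub (dvd_sub (dvd_sub (c5.mul_left _) (c1.mul_left _))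
              (c4.mul_left _)) (c2.mul_left _)) (c3.mul_left _)
          · have h2' : pderiv (v (b k)) (2 : MvPolynomial (Fin n) ℝ) = 0 := by
              rw [show (2 : MvPolynomial (Fin n) ℝ) = C 2 from rfl, pderiv_C]
            simp only [pderiv_mul, pderiv_pow, hl, hr, h2']
            ring
        simpa using h2
      have n1 : g i (b k) ≠ 0 := hbk ▸ hb i
      have n2 : g (b k) j ≠ 0 := by rw [gsymm, hbj]; exact hb j
      have n3 : g (b k) k ≠ 0 := by rw [gsymm]; exact hb k
      simp [n1, n2, n3] at hfree

end SignedRoots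

/-! ### Rank one from affineness of a determinant along a line. -/

section RankOne

variable {ι : Type*} [Fintype ι] [DecidableEq ι]

theorem Matrix.IsSymm.exists_eq_mul_diagonal_mul_transpose {K : Matrix ι ι ℝ} (hK : K.IsSymm) :
    ∃ (U : Matrix ι ι ℝ) (l : ι → ℝ), U * U.transpose = 1 ∧
      K = U * Matrix.diagonal l * U.transpose := by
  have hK' : K.IsHermitian := by
    rw [Matrix.IsHermitian, Matrix.conjTranspose_eq_transpose_of_trivial, hK.eq]
  have hstar : ((star hK'.eigenvectorUnitary : Matrix.unitaryGroup ι ℝ) : Matrix ι ι ℝ) =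
      (hK'.eigenvectorUnitary : Matrix ι ι ℝ).transpose :=
    Matrix.conjTranspose_eq_transpose_of_trivial _
  refine ⟨hK'.eigenvectorUnitary, hK'.eigenvalues, ?_, ?_⟩
  · rw [← hstar]
    exact Unitary.coe_mul_star_self _
  · have h := hK'.spectral_theorem
    rw [Unitary.conjStarAlgAut_apply] at h
    exact h

open scoped MatrixOrder Matrix.Norms.L2Operator in
/-- A positive definite and a symmetric matrix are simultaneously diagonalized by a congruence. -/
theorem Matrix.PosDef.exists_simultaneous_diagonal {P N : Matrix ι ι ℝ} (hP : P.PosDef)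
    (hN : N.IsSymm) : ∃ (R : Matrix ι ι ℝ) (l : ι → ℝ), R.det ≠ 0 ∧ P = R * R.transpose ∧
      N = R * Matrix.diagonal l * R.transpose := by
  obtain ⟨B, hB⟩ := CStarAlgebra.nonneg_iff_eq_star_mul_self.mp hP.posSemidef.nonneg
  rw [Matrix.star_eq_conjTranspose, Matrix.conjTranspose_eq_transpose_of_trivial] at hB
  have hdet : B.det ≠ 0 := by
    intro h
    have := hP.det_pos
    rw [hB, Matrix.det_mul, h, mul_zero] at this
    exact lt_irrefl _ this
  have hunit : IsUnit B.det := isUnit_iff_ne_zero.mpr hdet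
  -- With P = BᵀB, the congruence by B⁻¹ turns P into 1; an orthogonal diagonalization of the
  -- transformed N then leaves 1 unchanged.
  have hN' : (B⁻¹.transpose * N * B⁻¹).IsSymm := by
    rw [Matrix.IsSymm]
    simp [Matrix.transpose_mul, hN.eq, Matrix.mul_assoc]
  obtain ⟨U, l, hUU, hspec⟩ := hN'.exists_eq_mul_diagonal_mul_transpose
  refine ⟨B.transpose * U, l, ?_, ?_, ?_⟩
  · have h1 : U.det * U.det = 1 := by
      have := congrArg Matrix.det hUU
      rwa [Matrix.det_mul, Matrix.det_transpose, Matrix.det_one] at this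
    rw [Matrix.det_mul, Matrix.det_transpose]
    exact mul_ne_zero hdet (left_ne_zero_of_mul_eq_one h1)
  · rw [Matrix.transpose_mul, Matrix.transpose_transpose, Matrix.mul_assoc,
      ← Matrix.mul_assoc U, hUU, Matrix.one_mul, hB]
  · have h2 : B.transpose * (B⁻¹.transpose * N * B⁻¹) * B = N := by
      have h3 : B.transpose * B⁻¹.transpose = 1 := by
        rw [← Matrix.transpose_mul, Matrix.nonsing_inv_mul _ hunit, Matrix.transpose_one]
      have h4 : B⁻¹ * B = 1 := Matrix.nonsing_inv_mul _ hunit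
      rw [Matrix.mul_assoc, Matrix.mul_assoc, Matrix.mul_assoc, h4, Matrix.mul_one,
        ← Matrix.mul_assoc, h3, Matrix.one_mul]
    conv_lhs => rw [← h2, hspec]
    simp only [Matrix.transpose_mul, Matrix.transpose_transpose, Matrix.mul_assoc]

/-- If `det (P + t N)` is affine in `t` with `P` positive definite, then `N` has rank at most
one. -/
theorem Matrix.PosDef.exists_eq_smul_vecMulVec {P N : Matrix ι ι ℝ} (hP : P.PosDef)
    (hN : N.IsSymm) (q : Polynomial ℝ) (hq : q.natDegree ≤ 1)
    (heval : ∀ t, q.eval t = (P + t • N).det) :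
    ∃ (a : ℝ) (w : ι → ℝ), N = a • Matrix.vecMulVec w w := by
  obtain ⟨R, l, hR, hPR, hNR⟩ := hP.exists_simultaneous_diagonal hN
  -- The degree of this product counts the nonzero l k, so at most one is nonzero.
  have hq' : q = Polynomial.C (R.det * R.det) *
      ∏ k, (1 + Polynomial.C (l k) * Polynomial.X) := by
    refine Polynomial.funext fun t => ?_
    have h1 : P + t • N = R * Matrix.diagonal (fun k => 1 + l k * t) * R.transpose := by
      have h2 : Matrix.diagonal (fun k => 1 + l k * t) = 1 + t • Matrix.diagonal l := by
        rw [← Matrix.diagonal_one, ← Matrix.diagonal_smul, Matrix.diagonal_add]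
        congr 1
        ext k
        simp [mul_comm]
      rw [h2, hPR, hNR, Matrix.mul_add, Matrix.add_mul, Matrix.mul_one, Matrix.mul_smul,
        Matrix.smul_mul]
    rw [heval, h1, Matrix.det_mul, Matrix.det_mul, Matrix.det_diagonal, Matrix.det_transpose,
      Polynomial.eval_mul, Polynomial.eval_C, Polynomial.eval_prod]
    simp only [Polynomial.eval_add, Polynomial.eval_one, Polynomial.eval_mul, Polynomial.eval_C,
      Polynomial.eval_X]
    ring
  have hne : ∀ k, (1 + Polynomial.C (l k) * Polynomial.X : Polynomial ℝ) ≠ 0 := fun k h => by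
    simpa using congrArg (Polynomial.eval 0) h
  have hdeg : ∀ k, l k ≠ 0 →
      (1 + Polynomial.C (l k) * Polynomial.X : Polynomial ℝ).natDegree = 1 := fun k hk => by
    rw [add_comm, ← Polynomial.C_1]
    exact Polynomial.natDegree_linear hk
  rw [hq', Polynomial.natDegree_C_mul (mul_ne_zero hR hR),
    Polynomial.natDegree_prod _ _ fun k _ => hne k] at hq
  have huniq : ∀ j k, l j ≠ 0 → l k ≠ 0 → j = k := by
    intro j k hj hk
    by_contra hjk
    have h1 : ∑ m ∈ {j, k}, (1 + Polynomial.C (l m) * Polynomial.X : Polynomial ℝ).natDegree ≤ 1 :=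
      (Finset.sum_le_sum_of_subset (Finset.subset_univ _)).trans hq
    rw [Finset.sum_pair hjk, hdeg j hj, hdeg k hk] at h1
    lia
  by_cases hl : ∃ k, l k ≠ 0
  · obtain ⟨k, hk⟩ := hl
    refine ⟨l k, fun i => R i k, ?_⟩
    rw [hNR]
    ext i j
    rw [Matrix.mul_apply, Finset.sum_eq_single k]
    · simp [Matrix.vecMulVec_apply, Matrix.mul_diagonal]
      ring
    · intro m _ hm
      have : l m = 0 := by
        by_contra h
        exact hm (huniq m k h hk)
      simp [Matrix.mul_diagonal, this]
    · simp
  · push Not at hl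
    refine ⟨0, 0, ?_⟩
    rw [hNR, show l = 0 from funext hl]
    simp

end RankOne

/-! ### Derivations of the adjugate. -/

section AdjugateDerivative

variable {A : Type*} [CommRing A] [Algebra ℝ A] {ι : Type*} [Fintype ι]

theorem Derivation.map_matrix_mul (D : Derivation ℝ A A) (M N : Matrix ι ι A) :
    (M * N).map D = M.map D * N + M * N.map D := by
  ext i j
  simp only [Matrix.map_apply, Matrix.mul_apply, Matrix.add_apply, map_sum, D.leibniz, smul_eq_mul,
    Finset.sum_add_distrib]
  rw [add_comm]
  congr 1
  exact Finset.sum_congr rfl fun _ _ => mul_comm _ _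

/-- Differentiate M adj(M) = det(M)·1 and multiply by adj(M) on the left; no invertibility is
needed. -/
theorem Derivation.det_smul_map_adjugate [DecidableEq ι] (D : Derivation ℝ A A)
    (M : Matrix ι ι A) : M.det • M.adjugate.map D =
      D M.det • M.adjugate - M.adjugate * M.map D * M.adjugate := by
  have h1 : M.map D * M.adjugate + M * M.adjugate.map D = D M.det • (1 : Matrix ι ι A) := by
    rw [← D.map_matrix_mul, Matrix.mul_adjugate]
    ext i j
    rcases eq_or_ne i j with rfl | h
    · simp
    · simp [h]
  have h2 := congrArg (M.adjugate * ·) h1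
  simp only [Matrix.mul_add, ← Matrix.mul_assoc, Matrix.adjugate_mul, Matrix.mul_smul,
    Matrix.smul_mul, Matrix.one_mul, Matrix.mul_one] at h2
  rw [← h2]
  abel

end AdjugateDerivative

/-! ### Linear pencils with rank-one coefficients. -/

section Pencil

variable {n d : ℕ}

theorem map_eval_linearPencil (M : Fin n → Matrix (Fin d) (Fin d) ℝ) (x : Fin n → ℝ) :
    (linearPencil M).map (eval x) = ∑ i, x i • M i := by
  ext a b
  simp [linearPencil, Matrix.sum_apply]

theorem eval_det_linearPencil (M : Fin n → Matrix (Fin d) (Fin d) ℝ) (x : Fin n → ℝ) :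
    eval x (linearPencil M).det = (∑ i, x i • M i).det := by
  rw [RingHom.map_det, RingHom.mapMatrix_apply, map_eval_linearPencil]

theorem map_pderiv_linearPencil (M : Fin n → Matrix (Fin d) (Fin d) ℝ) (k : Fin n) :
    (linearPencil M).map (pderiv k) = (M k).map C := by
  ext a b : 2
  simp only [linearPencil, Matrix.map_apply, Matrix.sum_apply, Matrix.smul_apply, smul_eq_mul,
    map_sum, pderiv_mul, pderiv_C, mul_zero, add_zero]
  rw [Finset.sum_eq_single k]
  · rw [pderiv_X_self, one_mul]
  · intro j _ hj
    rw [pderiv_X_of_ne hj, zero_mul]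
  · simp

theorem isSymm_linearPencil {M : Fin n → Matrix (Fin d) (Fin d) ℝ} (hM : ∀ i, (M i).IsSymm) :
    (linearPencil M).IsSymm := by
  ext a b
  simp only [linearPencil, Matrix.transpose_apply, Matrix.sum_apply, Matrix.smul_apply,
    Matrix.map_apply, (hM _).apply]

-- By Jacobi, ∂_j det L = b wᵀ adj(L) w. Applying ∂_i to this quadratic form and using the adjugate
-- formula, the terms containing ∂_i det L cancel in Δ_ij, leaving the square of g = vᵀ adj(L) w.
open Matrix in
theorem wronskianDelta_det_linearPencil {M : Fin n → Matrix (Fin d) (Fin d) ℝ}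
    (hM : ∀ i, (M i).IsSymm) {i j : Fin n} {a b : ℝ}
    {v w : Fin d → ℝ} (hi : M i = a • vecMulVec v v) (hj : M j = b • vecMulVec w w) :
    ∃ g, wronskianDelta i j (linearPencil M).det = C (a * b) * g ^ 2 := by
  set L := linearPencil M
  set V : Fin d → MvPolynomial (Fin n) ℝ := fun k => C (v k)
  set W : Fin d → MvPolynomial (Fin n) ℝ := fun k => C (w k)
  have hDi : L.map (pderiv i) = (C a : MvPolynomial (Fin n) ℝ) • vecMulVec V V := by
    rw [map_pderiv_linearPencil, hi]
    ext k l : 2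
    simp [V, vecMulVec_apply]
  have hDj : L.map (pderiv j) = (C b : MvPolynomial (Fin n) ℝ) • vecMulVec W W := by
    rw [map_pderiv_linearPencil, hj]
    ext k l : 2
    simp [W, vecMulVec_apply]
  have hadj : L.adjugate.transpose = L.adjugate := by
    rw [adjugate_transpose, (isSymm_linearPencil hM).eq]
  have htr : ∀ (A : Matrix (Fin d) (Fin d) (MvPolynomial (Fin n) ℝ)) U,
      (A * vecMulVec U U).trace = U ⬝ᵥ A *ᵥ U := by
    intro A U
    rw [mul_vecMulVec, trace_vecMulVec, dotProduct_comm]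
  have e1 : pderiv i L.det = C a * (V ⬝ᵥ L.adjugate *ᵥ V) := by
    rw [Derivation.det_eq_trace, hDi, mul_smul_comm, trace_smul, htr, smul_eq_mul]
  have e2 : pderiv j L.det = C b * (W ⬝ᵥ L.adjugate *ᵥ W) := by
    rw [Derivation.det_eq_trace, hDj, mul_smul_comm, trace_smul, htr, smul_eq_mul]
  have e3 : L.det * pderiv i (W ⬝ᵥ L.adjugate *ᵥ W) =
      pderiv i L.det * (W ⬝ᵥ L.adjugate *ᵥ W) - C a * (V ⬝ᵥ L.adjugate *ᵥ W) ^ 2 := by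
    have h1 : pderiv i (W ⬝ᵥ L.adjugate *ᵥ W) = W ⬝ᵥ L.adjugate.map (pderiv i) *ᵥ W := by
      simp only [dotProduct, mulVec, map_sum, pderiv_mul, map_apply, W, pderiv_C]
      simp
    have h2 : W ⬝ᵥ L.adjugate *ᵥ V = V ⬝ᵥ L.adjugate *ᵥ W := by
      rw [dotProduct_mulVec, ← mulVec_transpose, hadj, dotProduct_comm]
    have h3 : W ⬝ᵥ (L.adjugate * vecMulVec V V * L.adjugate) *ᵥ W =
        (W ⬝ᵥ L.adjugate *ᵥ V) * (V ⬝ᵥ L.adjugate *ᵥ W) := by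
      rw [← mulVec_mulVec, ← mulVec_mulVec, vecMulVec_mulVec, mulVec_smul, dotProduct_smul]
      simp
    rw [h1, ← smul_eq_mul, ← dotProduct_smul, ← smul_mulVec, Derivation.det_smul_map_adjugate, hDi,
      sub_mulVec, dotProduct_sub, smul_mulVec, dotProduct_smul, mul_smul_comm, smul_mul_assoc,
      smul_mulVec, dotProduct_smul, h3, h2, smul_eq_mul, smul_eq_mul, sq]
  refine ⟨V ⬝ᵥ L.adjugate *ᵥ W, ?_⟩
  rw [wronskianDelta, e2, pderiv_C_mul, C_mul]
  linear_combination (-C b) * e3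

end Pencil

/-! ### Stability and nonnegativity of Δ_ij f. -/

section Laguerre

/-- Laguerre's inequality for real-rooted polynomials. -/
theorem Polynomial.laguerre_nonneg (p : Polynomial ℝ)
    (h : ∀ z : ℂ, aeval z p = 0 → z.im = 0) (t : ℝ) :
    0 ≤ (derivative p).eval t ^ 2 - p.eval t * (derivative (derivative p)).eval t := by
  induction hm : p.natDegree generalizing p with
  | zero =>
    rw [Polynomial.eq_C_of_natDegree_eq_zero hm]
    simp
  | succ m ih =>
    have hdeg : 0 < (p.map (algebraMap ℝ ℂ)).degree := by
      rw [Polynomial.degree_map]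
      exact Polynomial.natDegree_pos_iff_degree_pos.mp (by lia)
    obtain ⟨z, hz⟩ := Complex.exists_root hdeg
    have hz' : aeval z p = 0 := by rwa [Polynomial.IsRoot, Polynomial.eval_map_algebraMap] at hz
    have hzr : z = ((z.re : ℝ) : ℂ) := Complex.ext rfl (by simp [h z hz'])
    have hr : p.IsRoot z.re := by
      rw [hzr, ← Complex.coe_algebraMap, Polynomial.aeval_algebraMap_apply] at hz'
      simpa using hz'
    obtain ⟨q, rfl⟩ := Polynomial.dvd_iff_isRoot.mpr hr
    have hq0 : q ≠ 0 := by
      rintro rfl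
      simp at hm
    have hq := ih q (fun w hw => h w (by simp [hw])) (by
      rw [Polynomial.natDegree_mul (Polynomial.X_sub_C_ne_zero _) hq0,
        Polynomial.natDegree_X_sub_C] at hm
      lia)
    simp only [Polynomial.derivative_mul, Polynomial.derivative_sub, Polynomial.derivative_X,
      Polynomial.derivative_C, Polynomial.derivative_add, Polynomial.eval_add, Polynomial.eval_mul,
      Polynomial.eval_sub, Polynomial.eval_X, Polynomial.eval_C, sub_zero,
      one_mul]
    -- For p = (X - r) q the expression equals q² + (t - r)² (q'² - q q'').
    nlinarith [mul_nonneg (sq_nonneg (t - z.re)) hq, sq_nonneg (q.eval t)]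

variable {n : ℕ}

theorem aeval_lineRestrict (x v : Fin n → ℝ) (z : ℂ) (p : MvPolynomial (Fin n) ℝ) :
    Polynomial.aeval z (lineRestrict x v p) =
      eval (fun k => (x k : ℂ) + z * v k) (p.map (algebraMap ℝ ℂ)) := by
  induction p using MvPolynomial.induction_on with
  | C a => simp [lineRestrict]
  | add p q hp hq => simp [hp, hq]
  | mul_X p k hp => simp [hp, lineRestrict_X, mul_comm z]

theorem IsStable.im_eq_zero_of_aeval_lineRestrict {f : MvPolynomial (Fin n) ℝ}
    (hf : IsStable (f.map (algebraMap ℝ ℂ))) (x : Fin n → ℝ) {v : Fin n → ℝ} (hv : ∀ k, 0 < v k)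
    (z : ℂ) (hz : Polynomial.aeval z (lineRestrict x v f) = 0) : z.im = 0 := by
  have key : ∀ z : ℂ, 0 < z.im → Polynomial.aeval z (lineRestrict x v f) ≠ 0 := by
    intro z hz
    rw [aeval_lineRestrict]
    refine hf _ fun k => ?_
    simpa using mul_pos hz (hv k)
  rcases lt_trichotomy z.im 0 with h | h | h
  · refine absurd ?_ (key (starRingEnd ℂ z) (by simpa using h))
    rw [Polynomial.aeval_conj, hz, map_zero]
  · exact h
  · exact absurd hz (key z h)

/-- Lines in strictly positive directions give real-rooted restrictions; boundary directions, such
as e_i + e_j, are reached by letting ε tend to 0 in v + ε. -/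
theorem IsStable.directional_laguerre_nonneg {f : MvPolynomial (Fin n) ℝ}
    (hf : IsStable (f.map (algebraMap ℝ ℂ))) (x : Fin n → ℝ) {v : Fin n → ℝ} (hv : ∀ k, 0 ≤ v k) :
    0 ≤ (∑ k, v k * eval x (pderiv k f)) ^ 2 -
      eval x f * ∑ k, v k * ∑ l, v l * eval x (pderiv l (pderiv k f)) := by
  have hpos : ∀ v : Fin n → ℝ, (∀ k, 0 < v k) → 0 ≤ (∑ k, v k * eval x (pderiv k f)) ^ 2 -
      eval x f * ∑ k, v k * ∑ l, v l * eval x (pderiv l (pderiv k f)) := by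
    intro v hv
    have h := Polynomial.laguerre_nonneg (lineRestrict x v f)
      (hf.im_eq_zero_of_aeval_lineRestrict x hv) 0
    simpa only [derivative_lineRestrict, Polynomial.derivative_sum, Polynomial.derivative_C_mul,
      Polynomial.eval_finsetSum, Polynomial.eval_mul, Polynomial.eval_C,
      eval_zero_lineRestrict] using h
  let F : ℝ → ℝ := fun ε => (∑ k, (v k + ε) * eval x (pderiv k f)) ^ 2 -
      eval x f * ∑ k, (v k + ε) * ∑ l, (v l + ε) * eval x (pderiv l (pderiv k f))
  have hF : Continuous F := by fun_prop
  have h0 : 0 ≤ F 0 := by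
    refine ge_of_tendsto (hF.continuousWithinAt (s := Set.Ioi 0) (x := 0)) ?_
    filter_upwards [self_mem_nhdsWithin] with ε hε
    exact hpos _ fun k => add_pos_of_nonneg_of_pos (hv k) hε
  simpa [F] using h0

/-- Since Δ_ij f does not involve x_i or x_j, the point may be moved in these directions until ∂_i f
and ∂_j f both vanish. There Δ_ij f = -f ∂_i∂_j f, and Laguerre's inequality in direction e_i + e_j
bounds exactly this. Reaching that point requires ∂_i∂_j f ≠ 0. -/
theorem IsStable.eval_wronskianDelta_nonneg {f : MvPolynomial (Fin n) ℝ}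
    (hf : IsStable (f.map (algebraMap ℝ ℂ))) {i j : Fin n}
    (hi : pderiv i (pderiv i f) = 0) (hj : pderiv j (pderiv j f) = 0) (x : Fin n → ℝ)
    (hx : eval x (pderiv i (pderiv j f)) ≠ 0) : 0 ≤ eval x (wronskianDelta i j f) := by
  have hij : pderiv i (pderiv j (pderiv i f)) = 0 := by
    rw [pderiv_comm i j, hi, map_zero]
  have hji : pderiv j (pderiv i (pderiv j f)) = 0 := by
    rw [pderiv_comm j i, hj, map_zero]
  have hii : pderiv i (pderiv i (pderiv j f)) = 0 := by rw [pderiv_comm i j f, hij]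
  have hjj : pderiv j (pderiv j (pderiv i f)) = 0 := by rw [pderiv_comm j i f, hji]
  set e := eval x (pderiv i (pderiv j f)) with he
  set y := x + (-(eval x (pderiv j f)) / e) • Pi.single i 1 with hy
  set z := y + (-(eval x (pderiv i f)) / e) • Pi.single j 1 with hz
  have hyall : ∀ p, pderiv i (pderiv i p) = 0 →
      eval y p = eval x p + (-(eval x (pderiv j f)) / e) * eval x (pderiv i p) :=
    fun p hp => eval_add_single hp x _
  have hzall : ∀ p, pderiv j (pderiv j p) = 0 →
      eval z p = eval y p + (-(eval x (pderiv i f)) / e) * eval y (pderiv j p) :=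
    fun p hp => eval_add_single hp y _
  have hzi : eval z (pderiv i f) = 0 := by
    rw [hzall _ hjj, pderiv_comm j i, hyall _ (by rw [hi, map_zero]),
      hyall (pderiv i (pderiv j f)) (by rw [hii, map_zero]), hi, hii, ← he, map_zero]
    field_simp
    ring
  have hzj : eval z (pderiv j f) = 0 := by
    rw [hzall _ (by rw [hj, map_zero]), hj, hyall _ hii, ← he, map_zero]
    field_simp
    ring
  have hze : eval z (pderiv i (pderiv j f)) = e := by
    rw [hzall _ (by rw [hji, map_zero]), hji, hyall _ (by rw [hii, map_zero]), hii, ← he, map_zero, map_zero]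
    ring
  have hzf : eval z f * e = -eval x (wronskianDelta i j f) := by
    rw [hzall _ hj, hyall _ hi, hyall _ hii, ← he]
    simp only [wronskianDelta, map_sub, map_mul, ← he]
    field_simp
    ring
  have hlag := hf.directional_laguerre_nonneg z
    (v := Pi.single i 1 + Pi.single j 1) (fun k => add_nonneg
      (by rw [Pi.single_apply]; split <;> norm_num) (by rw [Pi.single_apply]; split <;> norm_num))
  have hsum : ∀ g : Fin n → ℝ,
      ∑ k, (Pi.single i 1 + Pi.single j 1 : Fin n → ℝ) k * g k = g i + g j := by
    intro g
    simp [add_mul, Finset.sum_add_distrib, Pi.single_apply]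
  simp only [hsum, hzi, hzj, hi, hj, pderiv_comm j i f, hze, map_zero] at hlag
  linarith

end Laguerre

/-! ### Homogeneity through the Euler derivation. -/

section Euler

variable {σ : Type*} [Fintype σ]

/-- The Euler derivation `∑ k, x_k ∂/∂x_k`. -/
noncomputable def eulerDerivation (σ : Type*) [Fintype σ] :
    Derivation ℝ (MvPolynomial σ ℝ) (MvPolynomial σ ℝ) :=
  ∑ k, (X k : MvPolynomial σ ℝ) • pderiv k

theorem eulerDerivation_apply (p : MvPolynomial σ ℝ) :
    eulerDerivation σ p = ∑ k, X k * pderiv k p := by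
  have h := congrFun (map_sum (Derivation.coeFnAddMonoidHom (R := ℝ) (A := MvPolynomial σ ℝ)
    (M := MvPolynomial σ ℝ)) (fun k => (X k : MvPolynomial σ ℝ) • pderiv k) Finset.univ) p
  rw [Finset.sum_apply] at h
  exact h

theorem eulerDerivation_X (k : σ) : eulerDerivation σ (X k) = X k := by
  classical
  rw [eulerDerivation_apply, Finset.sum_eq_single k]
  · simp
  · intro j _ hj
    rw [pderiv_X_of_ne hj.symm, mul_zero]
  · simp

theorem eulerDerivation_pderiv {p : MvPolynomial σ ℝ} {a : ℝ}
    (hp : eulerDerivation σ p = C a * p) (k : σ) :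
    eulerDerivation σ (pderiv k p) = C (a - 1) * pderiv k p := by
  classical
  have h := congrArg (pderiv k) hp
  rw [eulerDerivation_apply, map_sum, pderiv_C_mul] at h
  simp only [pderiv_mul, Finset.sum_add_distrib] at h
  rw [Finset.sum_eq_single k] at h
  · rw [pderiv_X_self, one_mul] at h
    rw [eulerDerivation_apply, C_sub, C_1, sub_mul, one_mul, ← h]
    simp only [pderiv_comm k]
    ring
  · intro j _ hj
    rw [pderiv_X_of_ne hj, zero_mul]
  · simp

theorem eulerDerivation_mul {p q : MvPolynomial σ ℝ} {a b : ℝ}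
    (hp : eulerDerivation σ p = C a * p) (hq : eulerDerivation σ q = C b * q) :
    eulerDerivation σ (p * q) = C (a + b) * (p * q) := by
  rw [Derivation.leibniz, hp, hq, smul_eq_mul, smul_eq_mul, C_add]
  ring

theorem eulerDerivation_of_sq {p q : MvPolynomial σ ℝ} {a : ℝ} (hpq : p ^ 2 = q)
    (hq : eulerDerivation σ q = C (2 * a) * q) : eulerDerivation σ p = C a * p := by
  rcases eq_or_ne p 0 with rfl | hp
  · simp
  · rw [← hpq, sq, Derivation.leibniz, smul_eq_mul, C_mul] at hq
    refine mul_left_cancel₀ (mul_ne_zero (two_ne_zero (α := MvPolynomial σ ℝ)) hp) ?_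
    rw [show (C 2 : MvPolynomial σ ℝ) = 2 from rfl] at hq
    linear_combination hq

theorem eulerDerivation_of_isHomogeneous {p : MvPolynomial σ ℝ} {d : ℕ} (hp : p.IsHomogeneous d) :
    eulerDerivation σ p = C (d : ℝ) * p := by
  rw [eulerDerivation_apply, hp.sum_X_mul_pderiv, nsmul_eq_mul]
  simp

/-- At x = u + tz one has tz = x - u, and Euler's identity evaluates the x-part. Knowing only the
derivative in the fixed direction u thus gives an ODE on every line through u. -/
theorem X_mul_derivative_lineRestrict {p : MvPolynomial σ ℝ} {a : ℝ}
    (hp : eulerDerivation σ p = C a * p) (u z : σ → ℝ) :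
    Polynomial.X * Polynomial.derivative (lineRestrict u z p) =
      Polynomial.C a * lineRestrict u z p -
        ∑ k, Polynomial.C (u k) * lineRestrict u z (pderiv k p) := by
  have h := congrArg (lineRestrict u z) hp
  rw [eulerDerivation_apply, map_sum, map_mul,
    show lineRestrict u z (C a) = Polynomial.C a by simp [lineRestrict]] at h
  rw [derivative_lineRestrict, ← h, Finset.mul_sum, ← Finset.sum_sub_distrib]
  refine Finset.sum_congr rfl fun k _ => ?_
  rw [map_mul, lineRestrict_X]
  ring

end Euler

/-! ### Uniqueness for regular singular systems. -/

section Uniqueness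

variable {ι : Type*} [Fintype ι]

/-- A solution of a linear differential system with a regular singular point at `0` vanishes if it
vanishes to an order beyond the exponent of the system. -/
theorem Polynomial.eq_zero_of_regular_singular_system [DecidableEq ι] {F : Polynomial ℝ} {c κ : ℝ}
    (hF : F.eval 0 = c) {N : ι → ι → Polynomial ℝ}
    (hN : ∀ k j, (N k j).eval 0 = if k = j then κ else 0) {E : ι → Polynomial ℝ}
    (hE : ∀ j, X * F * derivative (E j) = ∑ k, E k * N k j) {r : ℕ}
    (hr : ∀ j, X ^ r ∣ E j) (hκ : ∀ m : ℕ, r ≤ m → c * m ≠ κ) (j : ι) : E j = 0 := by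
  have key : ∀ m, r ≤ m → ∀ j, X ^ m ∣ E j := by
    intro m hm
    induction m, hm using Nat.le_induction with
    | base => exact hr
    | succ m hm ih =>
      choose e he using ih
      intro j
      have h := hE j
      -- After division by X^m, evaluation at 0 gives (cm - κ) e_j(0) = 0, which raises the order of
      -- vanishing by one.
      have hder : X * derivative (E j) = X ^ m * (C (m : ℝ) * e j + X * derivative (e j)) := by
        rw [he, derivative_mul, derivative_X_pow]
        rcases m with _ | m
        · simp
        · simp only [Nat.add_sub_cancel, pow_succ]
          ring
      have h2 : F * (C (m : ℝ) * e j + X * derivative (e j)) = ∑ k, e k * N k j := by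
        refine mul_left_cancel₀ (pow_ne_zero m X_ne_zero) ?_
        rw [Finset.mul_sum]
        simp only [← mul_assoc, ← he]
        rw [← h, mul_comm X F, mul_assoc F X, hder]
        ring
      have h3 := congrArg (eval 0) h2
      simp only [eval_mul, eval_add, eval_C, eval_X, zero_mul, add_zero, eval_finsetSum, hF, hN,
        mul_ite, mul_zero, Finset.sum_ite_eq', Finset.mem_univ, if_true] at h3
      have h4 : (c * m - κ) * (e j).eval 0 = 0 := by linear_combination h3
      have h5 := (mul_eq_zero.mp h4).resolve_left (sub_ne_zero.mpr (hκ m hm))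
      rw [he, pow_succ]
      refine mul_dvd_mul_left _ (X_dvd_iff.mpr ?_)
      rwa [coeff_zero_eq_eval_zero]
  refine eq_zero_of_dvd_of_natDegree_lt (key (r + (E j).natDegree + 1) (by lia) j) ?_
  rw [natDegree_X_pow]
  lia

variable {n d : ℕ}

/-- Homogeneous solutions of the system `f ∂_a E = E (∂_a f - B_a)` vanish if they vanish to high
order at the point `u = ∑ a, e_{v a}`. -/
theorem eq_zero_of_homogeneous_system [DecidableEq ι] {v : Fin d → Fin n}
    {f : MvPolynomial (Fin n) ℝ} {c κ : ℝ} {u : Fin n → ℝ} (hu : u = ∑ a, Pi.single (v a) 1)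
    (hfu : eval u f = c) (hdfu : ∀ a, eval u (pderiv (v a) f) = c)
    {B : ι → ι → MvPolynomial (Fin n) ℝ} (hB : ∀ k j, eval u (B k j) = if k = j then κ else 0)
    {E : ι → MvPolynomial (Fin n) ℝ} (hEeuler : ∀ j, eulerDerivation (Fin n) (E j) = C (d : ℝ) * E j)
    (hE : ∀ j, f * ∑ a, pderiv (v a) (E j) = (∑ a, pderiv (v a) f) * E j - ∑ k, E k * B k j)
    {r : ℕ} (hr : ∀ z j, Polynomial.X ^ r ∣ lineRestrict u z (E j))
    (hκ : ∀ m : ℕ, r ≤ m → c * m ≠ κ) (j : ι) : E j = 0 := by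
  have hline : ∀ z, lineRestrict u z (E j) = 0 := by
    intro z
    -- The extra diagonal term comes from Euler's identity and vanishes at 0, because d·f(u) and ∑
    -- ∂_a f(u) both equal dc; so the exponent is determined by κ alone.
    refine Polynomial.eq_zero_of_regular_singular_system (F := lineRestrict u z f) (c := c) (κ := κ)
      (N := fun k j => lineRestrict u z (B k j) + if k = j then
        Polynomial.C (d : ℝ) * lineRestrict u z f - lineRestrict u z (∑ a, pderiv (v a) f) else 0)
      (E := fun j => lineRestrict u z (E j)) ?_ ?_ ?_ (hr z) hκ j
    · rw [eval_zero_lineRestrict, hfu]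
    · intro k j
      rw [Polynomial.eval_add, eval_zero_lineRestrict, hB]
      split_ifs
      · rw [Polynomial.eval_sub, Polynomial.eval_mul, Polynomial.eval_C, eval_zero_lineRestrict,
          eval_zero_lineRestrict, hfu, map_sum]
        simp [hdfu]
      · simp
    · intro j
      have hsum : ∀ g : Fin n → Polynomial ℝ, ∑ k, Polynomial.C (u k) * g k = ∑ a, g (v a) := by
        intro g
        simp only [hu, Finset.sum_apply, map_sum, Finset.sum_mul]
        rw [Finset.sum_comm]
        refine Finset.sum_congr rfl fun a _ => ?_
        rw [Finset.sum_eq_single (v a)]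
        · simp
        · intro k _ hk
          simp [Pi.single_eq_of_ne hk]
        · simp
      have h1 := X_mul_derivative_lineRestrict (hEeuler j) u z
      rw [hsum] at h1
      have h2 := congrArg (lineRestrict u z) (hE j)
      simp only [map_sub, map_mul, map_sum] at h2
      simp only [mul_add, Finset.sum_add_distrib, mul_ite, mul_zero, Finset.sum_ite_eq',
        Finset.mem_univ, if_true, map_sum]
      linear_combination lineRestrict u z f * h1 - h2
  refine MvPolynomial.funext fun x => ?_
  have h := eval_lineRestrict u (fun k => x k - u k) 1 (E j)
  rw [hline] at h
  simpa using h.symm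

end Uniqueness

/-! ### Values of f and its derivatives at u = ∑ e_a. -/

section BasePoint

variable {n d : ℕ} {v : Fin d → Fin n} {f : MvPolynomial (Fin n) ℝ}

theorem sum_eq_of_isHomogeneous (hhom : f.IsHomogeneous d) {m : Fin n →₀ ℕ} (hm : f.coeff m ≠ 0) :
    ∑ k, m k = d := by
  have := hhom hm
  simpa [Finsupp.weight_apply, Finsupp.sum_fintype] using this

/-- A monomial that survives involves only the d affine variables, each to power at most one, and
has degree d; only the full product qualifies. -/
theorem eval_sum_single (hv : Function.Injective v) (hhom : f.IsHomogeneous d)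
    (haff : ∀ a, degreeOf (v a) f ≤ 1) (y : Fin d → ℝ) :
    eval (∑ a, Pi.single (v a) (y a)) f =
      f.coeff (∑ a, Finsupp.single (v a) 1) * ∏ a, y a := by
  classical
  set m₀ : Fin n →₀ ℕ := ∑ a, Finsupp.single (v a) 1 with hm₀
  set x : Fin n → ℝ := ∑ a, Pi.single (v a) (y a) with hx
  have hmv : ∀ a, m₀ (v a) = 1 := fun a => by
    simp [hm₀, Finsupp.single_apply, hv.eq_iff]
  have hxv : ∀ a, x (v a) = y a := fun a => by
    simp [hx, Pi.single_apply, hv.eq_iff]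
  have hm0 : ∀ k, (∀ a, v a ≠ k) → m₀ k = 0 := fun k hk => by
    simp [hm₀, hk]
  have hx0 : ∀ k, (∀ a, v a ≠ k) → x k = 0 := fun k hk => by
    rw [hx, Finset.sum_apply]
    exact Finset.sum_eq_zero fun a _ => Pi.single_eq_of_ne (hk a).symm _
  have hprod : ∏ k, x k ^ m₀ k = ∏ a, y a := by
    rw [← Finset.prod_subset (Finset.subset_univ (Finset.univ.image v)),
      Finset.prod_image fun a _ b _ h => hv h]
    · exact Finset.prod_congr rfl fun a _ => by rw [hxv, hmv, pow_one]
    · intro k _ hk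
      rw [hm0 k fun a ha => hk (Finset.mem_image.mpr ⟨a, Finset.mem_univ _, ha⟩), pow_zero]
  have hm₀sum : ∑ k, m₀ k = d := by
    simp only [hm₀, Finsupp.coe_finsetSum, Finset.sum_apply]
    rw [Finset.sum_comm]
    simp [Finsupp.single_apply]
  rw [eval_eq', Finset.sum_eq_single m₀, hprod]
  · intro m hm hne
    have hcoeff := mem_support_iff.mp hm
    by_contra h
    have hprod0 := right_ne_zero_of_mul h
    rw [Finset.prod_ne_zero_iff] at hprod0
    have hle : ∀ k ∈ Finset.univ, m k ≤ m₀ k := by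
      intro k _
      by_cases hk : ∃ a, v a = k
      · obtain ⟨a, rfl⟩ := hk
        rw [hmv]
        exact (monomial_le_degreeOf _ hm).trans (haff a)
      · push Not at hk
        have h1 := hprod0 k (Finset.mem_univ _)
        rw [hx0 k hk] at h1
        by_contra h2
        exact h1 (zero_pow (by lia))
    refine hne (Finsupp.ext fun k => ?_)
    refine (Finset.sum_eq_sum_iff_of_le hle).mp ?_ k (Finset.mem_univ _)
    rw [hm₀sum, sum_eq_of_isHomogeneous hhom hcoeff]
  · intro h
    rw [notMem_support_iff.mp h, zero_mul]

theorem sum_single_add_smul_single (y : Fin d → ℝ) (a : Fin d) (t : ℝ) :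
    (∑ b, Pi.single (v b) (y b) : Fin n → ℝ) + t • Pi.single (v a) 1 =
      ∑ b, Pi.single (v b) ((y + t • Pi.single a 1 : Fin d → ℝ) b) := by
  have h : (t • Pi.single (v a) 1 : Fin n → ℝ) =
      ∑ b, Pi.single (v b) ((t • Pi.single a 1 : Fin d → ℝ) b) := by
    rw [Finset.sum_eq_single a]
    · rw [← Pi.single_smul]
      simp
    · intro b _ hb
      simp [Pi.single_eq_of_ne hb]
    · simp
  rw [h, ← Finset.sum_add_distrib]
  refine Finset.sum_congr rfl fun b _ => ?_
  rw [← Pi.single_add, Pi.add_apply]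

theorem mul_eval_pderiv_sum_single (hv : Function.Injective v) (hhom : f.IsHomogeneous d)
    (haff : ∀ a, degreeOf (v a) f ≤ 1) (y : Fin d → ℝ) (a : Fin d) :
    y a * eval (∑ b, Pi.single (v b) (y b)) (pderiv (v a) f) =
      f.coeff (∑ a, Finsupp.single (v a) 1) * ∏ b, y b := by
  -- The shift by -y a kills the a-th coordinate, and with it f.
  have h := eval_add_single (pderiv_pderiv_self_eq_zero (haff a))
    (∑ b, Pi.single (v b) (y b)) (-y a)
  rw [sum_single_add_smul_single, eval_sum_single hv hhom haff, eval_sum_single hv hhom haff,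
    Finset.prod_eq_zero (Finset.mem_univ a) (by simp)] at h
  linarith

theorem eval_base (hv : Function.Injective v) (hhom : f.IsHomogeneous d)
    (haff : ∀ a, degreeOf (v a) f ≤ 1) :
    eval (∑ a, Pi.single (v a) 1) f = f.coeff (∑ a, Finsupp.single (v a) 1) := by
  simpa using eval_sum_single hv hhom haff fun _ => 1

theorem eval_pderiv_base (hv : Function.Injective v) (hhom : f.IsHomogeneous d)
    (haff : ∀ a, degreeOf (v a) f ≤ 1) (a : Fin d) :
    eval (∑ a, Pi.single (v a) 1) (pderiv (v a) f) = f.coeff (∑ a, Finsupp.single (v a) 1) := by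
  simpa using mul_eval_pderiv_sum_single hv hhom haff (fun _ => 1) a

theorem eval_pderiv_pderiv_base (hv : Function.Injective v) (hhom : f.IsHomogeneous d)
    (haff : ∀ a, degreeOf (v a) f ≤ 1) {a b : Fin d} (hab : a ≠ b) :
    eval (∑ a, Pi.single (v a) 1) (pderiv (v a) (pderiv (v b) f)) =
      f.coeff (∑ a, Finsupp.single (v a) 1) := by
  have h1 := eval_add_single (i := v a) (p := pderiv (v b) f)
    (by rw [pderiv_comm (v a) (v b), pderiv_comm (v a) (v b), pderiv_pderiv_self_eq_zero (haff a),
      map_zero]) (∑ a, Pi.single (v a) 1) (-1)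
  have h2 := mul_eval_pderiv_sum_single hv hhom haff
    ((fun _ => 1) + (-1 : ℝ) • Pi.single a 1 : Fin d → ℝ) b
  rw [← sum_single_add_smul_single, h1, eval_pderiv_base hv hhom haff,
    Finset.prod_eq_zero (Finset.mem_univ a) (by simp)] at h2
  simp [Pi.single_eq_of_ne hab.symm] at h2
  linarith

end BasePoint

/-! ### Building the pencil from the signed roots. -/

section Construction

variable {n d : ℕ}

theorem linearPencil_apply (M : Fin n → Matrix (Fin d) (Fin d) ℝ) (i j : Fin d) :
    linearPencil M i j = ∑ k, X k * C (M k i j) := by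
  simp [linearPencil, Matrix.sum_apply]

theorem map_eulerDerivation_linearPencil (M : Fin n → Matrix (Fin d) (Fin d) ℝ) :
    (linearPencil M).map (eulerDerivation (Fin n)) = linearPencil M := by
  refine Matrix.ext fun i j => ?_
  have h : ∀ k, eulerDerivation (Fin n) (X k * C (M k i j)) = X k * C (M k i j) := by
    intro k
    rw [Derivation.leibniz, eulerDerivation_X, smul_eq_mul, smul_eq_mul,
      show (C (M k i j) : MvPolynomial (Fin n) ℝ) = algebraMap ℝ _ (M k i j) from rfl,
      Derivation.map_algebraMap, mul_zero, zero_add, mul_comm]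
  rw [Matrix.map_apply, linearPencil_apply, map_sum]
  exact Finset.sum_congr rfl fun k _ => h k

theorem X_sq_dvd_lineRestrict {p : MvPolynomial (Fin n) ℝ} {u : Fin n → ℝ} (h0 : eval u p = 0)
    (h1 : ∀ k, eval u (pderiv k p) = 0) (z : Fin n → ℝ) :
    Polynomial.X ^ 2 ∣ lineRestrict u z p := by
  rw [Polynomial.X_pow_dvd_iff]
  intro m hm
  interval_cases m
  · rw [Polynomial.coeff_zero_eq_eval_zero, eval_zero_lineRestrict, h0]
  · have h := Polynomial.coeff_derivative (lineRestrict u z p) 0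
    rw [derivative_lineRestrict, Polynomial.coeff_zero_eq_eval_zero, Polynomial.eval_finsetSum] at h
    simp only [Polynomial.eval_mul, eval_zero_lineRestrict, h1] at h
    simpa using h.symm

theorem eulerDerivation_wronskianDelta {f : MvPolynomial (Fin n) ℝ} {a : ℝ}
    (hf : eulerDerivation (Fin n) f = C a * f) (i j : Fin n) :
    eulerDerivation (Fin n) (wronskianDelta i j f) = C (2 * (a - 1)) * wronskianDelta i j f := by
  have h1 := eulerDerivation_pderiv hf i
  have h2 := eulerDerivation_pderiv hf j
  have h3 := eulerDerivation_mul h1 h2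
  have h4 := eulerDerivation_mul hf (eulerDerivation_pderiv h2 i)
  have e1 : a - 1 + (a - 1) = 2 * (a - 1) := by ring
  have e2 : a + (a - 1 - 1) = 2 * (a - 1) := by ring
  rw [e1] at h3
  rw [e2] at h4
  rw [wronskianDelta, map_sub, h3, h4, ← mul_sub]

/-- If `L` is a linear pencil normalized at `u` and `L G = f`, where `∂_a L` is the `a`-th diagonal
matrix unit and `G` has diagonal `∂_a f`, then `f` is a multiple of `det L`. -/
theorem eq_C_mul_det_of_mul_eq_smul_one {v : Fin d → Fin n} {f : MvPolynomial (Fin n) ℝ} {c : ℝ}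
    (hc : c ≠ 0) {u : Fin n → ℝ} (hu : u = ∑ a, Pi.single (v a) 1)
    (hfu : eval u f = c) (hdfu : ∀ a, eval u (pderiv (v a) f) = c)
    (hfe : eulerDerivation (Fin n) f = C (d : ℝ) * f) {M : Fin n → Matrix (Fin d) (Fin d) ℝ}
    (hMv : ∀ a, M (v a) = Matrix.single a a 1) (hMu : ∑ k, u k • M k = 1)
    {G : Matrix (Fin d) (Fin d) (MvPolynomial (Fin n) ℝ)} (hG : ∀ a, G a a = pderiv (v a) f)
    (hLG : linearPencil M * G = f • 1) : f = C c * (linearPencil M).det := by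
  set L := linearPencil M with hL
  -- Multiply LG = f·1 by adj(L) and compare diagonal entries: ∂_a det L is adj(L)_aa, while G_aa =
  -- ∂_a f.
  have hpd : ∀ a, f * pderiv (v a) L.det = pderiv (v a) f * L.det := by
    intro a
    have h1 : pderiv (v a) L.det = L.adjugate a a := by
      rw [Derivation.det_eq_trace, map_pderiv_linearPencil, hMv]
      have : (Matrix.single a a (1 : ℝ)).map (C : ℝ →+* MvPolynomial (Fin n) ℝ) =
          Matrix.single a a 1 := by
        ext i j : 2
        rw [Matrix.map_apply, Matrix.single_apply, Matrix.single_apply, apply_ite C, C_1, C_0]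
      rw [this, Matrix.trace_mul_single]
      simp
    have h2 := congrArg (fun A => (L.adjugate * A) a a) hLG
    simp only [← Matrix.mul_assoc, Matrix.adjugate_mul, Matrix.smul_mul, Matrix.one_mul,
      Matrix.mul_smul, Matrix.mul_one, Matrix.smul_apply, smul_eq_mul, hG] at h2
    rw [h1, ← h2, mul_comm]
  have heul : eulerDerivation (Fin n) L.det = C (d : ℝ) * L.det := by
    rw [Derivation.det_eq_trace, hL, map_eulerDerivation_linearPencil, Matrix.adjugate_mul,
      Matrix.trace_smul, Matrix.trace_one, smul_eq_mul, Fintype.card_fin, mul_comm]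
    simp
  have hLu : eval u L.det = 1 := by rw [hL, eval_det_linearPencil, hMu, Matrix.det_one]
  have hzero : eval u (f - C c * L.det) = 0 := by
    rw [map_sub, map_mul, hfu, hLu, eval_C, mul_one, sub_self]
  -- The system is scalar with exponent 0, so vanishing at u suffices.
  have h := eq_zero_of_homogeneous_system (ι := Unit) (κ := 0) (r := 1) hu hfu hdfu
    (B := fun _ _ => 0) (by simp) (E := fun _ => f - C c * L.det) ?_ ?_ ?_ ?_ ()
  · exact sub_eq_zero.mp h
  · intro _
    have hC : eulerDerivation (Fin n) (C c) = 0 :=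
      Derivation.map_algebraMap (eulerDerivation (Fin n)) c
    rw [map_sub, Derivation.leibniz, hC, hfe, heul, smul_eq_mul, smul_zero, add_zero]
    ring
  · intro _
    simp only [map_sub, pderiv_C_mul, Finset.sum_sub_distrib, mul_zero, Finset.sum_const_zero,
      sub_zero, mul_sub]
    have : f * ∑ a, C c * pderiv (v a) L.det = C c * ((∑ a, pderiv (v a) f) * L.det) := by
      rw [Finset.mul_sum, Finset.sum_mul, Finset.mul_sum]
      exact Finset.sum_congr rfl fun a _ => by linear_combination C c * hpd a
    rw [this]
    ring
  · intro z _
    rw [pow_one, Polynomial.X_dvd_iff, Polynomial.coeff_zero_eq_eval_zero, eval_zero_lineRestrict,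
      hzero]
  · intro m hm
    have : (m : ℝ) ≠ 0 := by positivity
    exact mul_ne_zero hc this

/-- The pencil whose first derivatives at the base point match those of a signed root matrix `G`
is inverse to `G` up to the factor `f`. -/
theorem linearPencil_mul_eq_smul_one {v : Fin d → Fin n} {f : MvPolynomial (Fin n) ℝ} {c : ℝ}
    (hc : c ≠ 0) {u : Fin n → ℝ} (hu : u = ∑ a, Pi.single (v a) 1)
    (hfu : eval u f = c) (hdfu : ∀ a, eval u (pderiv (v a) f) = c)
    (hfe : eulerDerivation (Fin n) f = C (d : ℝ) * f) {M : Fin n → Matrix (Fin d) (Fin d) ℝ}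
    (hMv : ∀ a, M (v a) = Matrix.single a a 1) (hMu : ∑ k, u k • M k = 1)
    {G : Matrix (Fin d) (Fin d) (MvPolynomial (Fin n) ℝ)}
    (hGu : ∀ i j, eval u (G i j) = if i = j then c else 0)
    (hGe : ∀ i j, eulerDerivation (Fin n) (G i j) = C ((d : ℝ) - 1) * G i j)
    (Gode : ∀ i j a, f * pderiv (v a) (G i j) = G i j * pderiv (v a) f - G i a * G a j)
    (hbase : ∀ k i j, c * M k i j =
      eval u (pderiv k (if i = j then f else 0)) - eval u (pderiv k (G i j))) :
    linearPencil M * G = f • 1 := by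
  set L := linearPencil M with hL
  have hLu : ∀ i j, eval u (L i j) = if i = j then 1 else 0 := by
    intro i j
    have h := congrFun (congrFun (map_eval_linearPencil M u) i) j
    rwa [hMu, Matrix.map_apply, Matrix.one_apply] at h
  have hLe : ∀ i j, eulerDerivation (Fin n) (L i j) = L i j := fun i j =>
    congrFun (congrFun (map_eulerDerivation_linearPencil M) i) j
  have hLd : ∀ k i j, pderiv k (L i j) = C (M k i j) := fun k i j =>
    congrFun (congrFun (map_pderiv_linearPencil M k) i) j
  let E : Fin d → Fin d → MvPolynomial (Fin n) ℝ := fun i j =>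
    ∑ l, L i l * G l j - if i = j then f else 0
  have hE0 : ∀ i j, E i j = 0 := by
    intro i
    -- Each row of LG - f·1 solves the system with B = G. Since G(u) = c·1 the exponent is 1, so
    -- second-order vanishing is needed; `hbase` supplies the first-order part.
    refine eq_zero_of_homogeneous_system (κ := c) (r := 2) hu hfu hdfu hGu ?_ ?_ ?_ ?_
    · intro j
      simp only [E, map_sub, map_sum, Derivation.leibniz, hGe, hLe, smul_eq_mul,
        apply_ite (eulerDerivation (Fin n)), hfe, map_zero, mul_sub, Finset.mul_sum, mul_ite,
        mul_zero, C_1]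
      congr 1
      exact Finset.sum_congr rfl fun l _ => by ring
    · intro j
      have hode : ∀ a, f * pderiv (v a) (E i j) =
          pderiv (v a) f * E i j - E i a * G a j := by
        intro a
        have h1 : pderiv (v a) (E i j) = (if i = a then G a j else 0) +
            ∑ l, L i l * pderiv (v a) (G l j) - if i = j then pderiv (v a) f else 0 := by
          have h2 : ∑ l, pderiv (v a) (L i l) * G l j = if i = a then G a j else 0 := by
            simp only [hLd, hMv, Matrix.single_apply]
            rw [Finset.sum_eq_single a]
            · rcases eq_or_ne a i with rfl | h
              · simp
              · simp [h, h.symm]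
            · intro l _ hl
              simp [hl.symm]
            · simp
          simp only [E, map_sub, map_sum, pderiv_mul, Finset.sum_add_distrib,
            apply_ite (pderiv (v a)), map_zero, h2]
        have h3 : f * ∑ l, L i l * pderiv (v a) (G l j) =
            pderiv (v a) f * ∑ l, L i l * G l j - (∑ l, L i l * G l a) * G a j := by
          rw [Finset.mul_sum, Finset.mul_sum, Finset.sum_mul, ← Finset.sum_sub_distrib]
          exact Finset.sum_congr rfl fun l _ => by linear_combination L i l * Gode l j a
        rw [h1, mul_sub, mul_add, h3]
        simp only [E]
        split_ifs <;> ring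
      rw [Finset.mul_sum, Finset.sum_mul, ← Finset.sum_sub_distrib]
      exact Finset.sum_congr rfl fun a _ => hode a
    · intro z j
      refine X_sq_dvd_lineRestrict ?_ ?_ z
      · simp only [E, map_sub, map_sum, map_mul, hLu, hGu, apply_ite (eval u), hfu, map_zero]
        simp
      · intro k
        have h1 := hbase k i j
        simp only [E, map_sub, map_sum, pderiv_mul, map_add, map_mul, hLu, hGu, hLd, eval_C,
          Finset.sum_add_distrib]
        simp only [mul_ite, mul_zero, ite_mul, one_mul, zero_mul, Finset.sum_ite_eq',
          Finset.sum_ite_eq, Finset.mem_univ, if_true]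
        linarith
    · intro m hm h
      have h1 : (m : ℝ) = 1 := mul_left_cancel₀ hc (by rw [h, mul_one])
      have h2 : (2 : ℝ) ≤ m := by exact_mod_cast hm
      linarith
  refine Matrix.ext fun i j => ?_
  have h := hE0 i j
  simp only [E, sub_eq_zero] at h
  rw [Matrix.mul_apply, h, Matrix.smul_apply, Matrix.one_apply]
  simp

/-- A form with square `Δ_ij f` is a multiple of the determinant of a symmetric linear pencil. -/
theorem exists_linearPencil_of_isSquare {v : Fin d → Fin n} (hv : Function.Injective v)
    {f : MvPolynomial (Fin n) ℝ} (hhom : f.IsHomogeneous d) (haff : ∀ a, degreeOf (v a) f ≤ 1)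
    {c : ℝ} (hcf : c = f.coeff (∑ a, Finsupp.single (v a) 1)) (hc : c ≠ 0)
    (hsq : ∀ i j, IsSquare (wronskianDelta (v i) (v j) f)) :
    ∃ M : Fin n → Matrix (Fin d) (Fin d) ℝ, (∀ k, (M k).IsSymm) ∧
      ∑ k, (∑ a, Pi.single (v a) 1 : Fin n → ℝ) k • M k = 1 ∧
      f = C c * (linearPencil M).det := by
  set u : Fin n → ℝ := ∑ a, Pi.single (v a) 1 with hu
  have hfu : eval u f = c := by rw [hcf]; exact eval_base hv hhom haff
  have hdfu : ∀ a, eval u (pderiv (v a) f) = c := fun a => by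
    rw [hcf]; exact eval_pderiv_base hv hhom haff a
  have hddfu : ∀ a b, a ≠ b → eval u (pderiv (v a) (pderiv (v b) f)) = c := fun a b hab => by
    rw [hcf]; exact eval_pderiv_pderiv_base hv hhom haff hab
  have hne : ∀ a, pderiv (v a) f ≠ 0 := fun a h => by
    have := hdfu a
    rw [h, map_zero] at this
    exact hc this.symm
  obtain ⟨G, Gdiag, Gsymm, Gsq, Gode⟩ := exists_signed_roots v haff hne hsq
  have hGu : ∀ i j, eval u (G i j) = if i = j then c else 0 := by
    intro i j
    split_ifs with h
    · rw [← h, Gdiag, hdfu]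
    · have h1 := congrArg (eval u) (Gsq i j)
      rw [wronskianDelta, map_pow, map_sub, map_mul, map_mul, hfu, hdfu, hdfu, hddfu i j h,
        sub_self] at h1
      exact pow_eq_zero_iff two_ne_zero |>.mp h1
  have hDGu : ∀ i j a, eval u (pderiv (v a) (G i j)) =
      (if i = j then c else 0) - if i = a ∧ a = j then c else 0 := by
    intro i j a
    have h1 := congrArg (eval u) (Gode i j a)
    rw [map_mul, map_sub, map_mul, map_mul, hfu, hdfu, hGu, hGu, hGu] at h1
    refine mul_left_cancel₀ hc (h1.trans ?_)
    rcases eq_or_ne i j with rfl | h3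
    · rcases eq_or_ne i a with rfl | h2
      · simp
      · simp [h2]
    · rcases eq_or_ne i a with rfl | h2
      · simp [h3]
      · simp [h2, h3]
  have hfe := eulerDerivation_of_isHomogeneous hhom
  have hGe : ∀ i j, eulerDerivation (Fin n) (G i j) = C ((d : ℝ) - 1) * G i j := by
    intro i j
    exact eulerDerivation_of_sq (Gsq i j) (eulerDerivation_wronskianDelta hfe _ _)
  -- The factor x_i makes the derivatives of p at u vanish in the affine directions, where M is
  -- prescribed to be a matrix unit; in the other directions it only contributes u_i = 1.
  let p : Fin d → Fin d → MvPolynomial (Fin n) ℝ := fun i j =>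
    (if i = j then f else 0) - X (v i) * G i j
  let N : Fin n → Matrix (Fin d) (Fin d) ℝ := fun k => Matrix.of fun i j =>
    eval u (pderiv k (p i j)) / c
  have huv : ∀ a, u (v a) = 1 := fun a => by simp [hu, Pi.single_apply, hv.eq_iff]
  have hpderivX : ∀ a i, pderiv (v a) (X (v i) : MvPolynomial (Fin n) ℝ) = if i = a then 1 else 0 := by
    intro a i
    split_ifs with h
    · rw [h, pderiv_X_self]
    · exact pderiv_X_of_ne (hv.ne h)
  have hNv : ∀ a, N (v a) = 0 := by
    intro a
    ext i j
    have h1 : eval u (pderiv (v a) (p i j)) = 0 := by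
      simp only [p, map_sub, pderiv_mul, map_add, map_mul, hpderivX, hGu, hDGu, eval_X, huv,
        apply_ite (pderiv (v a)), apply_ite (eval u), map_zero, map_one, hdfu]
      rcases eq_or_ne i j with rfl | h3
      · rcases eq_or_ne i a with rfl | h2
        · simp
        · simp [h2]
      · rcases eq_or_ne i a with rfl | h2
        · simp [h3]
        · simp [h2, h3]
    simp [N, h1]
  have hNsymm : ∀ k, (N k).IsSymm := by
    intro k
    refine Matrix.IsSymm.ext fun i j => ?_
    rcases eq_or_ne i j with rfl | hij
    · exact Eq.refl _
    · have h1 : ∀ i j, i ≠ j → eval u (pderiv k (p i j)) = -eval u (pderiv k (G i j)) := by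
        intro i j h
        simp [p, h, hGu, huv]
      simp only [N, Matrix.of_apply]
      rw [h1 i j hij, h1 j i hij.symm, Gsymm]
  let M : Fin n → Matrix (Fin d) (Fin d) ℝ := fun k =>
    (∑ a, if v a = k then Matrix.single a a 1 else 0) + N k
  have hMv : ∀ a, M (v a) = Matrix.single a a 1 := by
    intro a
    simp only [M, hNv, add_zero, hv.eq_iff]
    simp
  have hMsymm : ∀ k, (M k).IsSymm := by
    intro k
    refine Matrix.IsSymm.add ?_ (hNsymm k)
    rw [Matrix.IsSymm, Matrix.transpose_sum]
    refine Finset.sum_congr rfl fun a _ => ?_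
    split_ifs <;> simp
  have husum : ∀ g : Fin n → Matrix (Fin d) (Fin d) ℝ, ∑ k, u k • g k = ∑ a, g (v a) := by
    intro g
    simp only [hu, Finset.sum_apply, Finset.sum_smul]
    rw [Finset.sum_comm]
    refine Finset.sum_congr rfl fun a _ => ?_
    rw [Finset.sum_eq_single (v a)]
    · simp
    · intro k _ hk
      simp [Pi.single_eq_of_ne hk]
    · simp
  have hMu : ∑ k, u k • M k = 1 := by
    rw [husum]
    simp only [hMv]
    ext i j
    simp only [Matrix.sum_apply, Matrix.single_apply, Matrix.one_apply]
    rcases eq_or_ne i j with rfl | h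
    · simp
    · rw [if_neg h]
      exact Finset.sum_eq_zero fun a _ => if_neg fun ha => h (ha.1.symm.trans ha.2)
  refine ⟨M, hMsymm, hMu, ?_⟩
  refine eq_C_mul_det_of_mul_eq_smul_one hc hu hfu hdfu hfe hMv hMu Gdiag ?_
  refine linearPencil_mul_eq_smul_one hc hu hfu hdfu hfe hMv hMu hGu hGe Gode fun k i j => ?_
  by_cases hk : ∃ a, v a = k
  · obtain ⟨a, rfl⟩ := hk
    rw [hMv, hDGu, Matrix.single_apply, apply_ite (pderiv (v a)), apply_ite (eval u), hdfu,
      map_zero, map_zero]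
    simp only [eq_comm (a := a) (b := i)]
    split_ifs <;> ring
  · push Not at hk
    have h2 : M k = N k := by simp [M, hk]
    have h3 : pderiv k (X (v i) : MvPolynomial (Fin n) ℝ) = 0 := pderiv_X_of_ne (hk i)
    rw [h2]
    simp only [N, p, Matrix.of_apply, map_sub, pderiv_mul, h3, zero_mul, zero_add, map_mul,
      eval_X, huv, one_mul]
    field_simp

end Construction

/-! ### The sign of f on the closed orthant. -/

section Positivity

variable {n d : ℕ} {f : MvPolynomial (Fin n) ℝ}

theorem eval_mul_of_isHomogeneous (hhom : f.IsHomogeneous d) (t : ℝ) (w : Fin n → ℝ) :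
    eval (fun k => t * w k) f = t ^ d * eval w f := by
  rw [eval_eq', eval_eq', Finset.mul_sum]
  refine Finset.sum_congr rfl fun m hm => ?_
  simp only [mul_pow, Finset.prod_mul_distrib, Finset.prod_pow_eq_pow_sum,
    sum_eq_of_isHomogeneous hhom (mem_support_iff.mp hm)]
  ring

/-- A zero w would by homogeneity give f(tw) = 0 identically in t, in particular at t = i, where
stability forbids it. -/
theorem IsStable.eval_ne_zero_of_pos (hf : IsStable (f.map (algebraMap ℝ ℂ)))
    (hhom : f.IsHomogeneous d) {w : Fin n → ℝ} (hw : ∀ k, 0 < w k) : eval w f ≠ 0 := by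
  intro h
  have hzero : lineRestrict 0 w f = 0 := by
    refine Polynomial.funext fun t => ?_
    have := eval_mul_of_isHomogeneous hhom t w
    rw [h, mul_zero] at this
    simpa [eval_lineRestrict] using this
  have := hf.im_eq_zero_of_aeval_lineRestrict 0 hw Complex.I (by rw [hzero, map_zero])
  simp at this

theorem IsStable.eval_nonneg_of_nonneg (hf : IsStable (f.map (algebraMap ℝ ℂ)))
    (hhom : f.IsHomogeneous d) {e u : Fin n → ℝ} (he : ∀ k, 0 < e k) (hfe : 0 < eval e f)
    (hu : ∀ k, 0 ≤ u k) : 0 ≤ eval u f := by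
  by_contra hneg
  push Not at hneg
  have h0 : (lineRestrict e (u - e) f).eval 0 = eval e f := eval_zero_lineRestrict _ _ _
  have h1 : (lineRestrict e (u - e) f).eval 1 = eval u f := by
    rw [eval_lineRestrict]
    congr 2
    ext k
    simp
  -- A sign change between e and u produces a zero with s < 1, which lies in the open orthant.
  obtain ⟨s, hs, hs0⟩ := intermediate_value_Icc' zero_le_one
    (f := fun s => (lineRestrict e (u - e) f).eval s)
    (Polynomial.continuous _).continuousOn
    (show (0 : ℝ) ∈ _ from ⟨by simp only [h1]; exact hneg.le, by simp only [h0]; exact hfe.le⟩)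
  have hs1 : s < 1 := lt_of_le_of_ne hs.2 fun h => by
    rw [h] at hs0
    exact hneg.ne (h1.symm.trans hs0)
  refine hf.eval_ne_zero_of_pos hhom (w := fun k => e k + s * (u - e) k) (fun k => ?_)
    ((eval_lineRestrict _ _ _ _).symm.trans hs0)
  have : e k + s * (u - e) k = (1 - s) * e k + s * u k := by
    rw [Pi.sub_apply]
    ring
  rw [this]
  exact add_pos_of_pos_of_nonneg (mul_pos (by linarith) (he k)) (mul_nonneg hs.1 (hu k))

end Positivity

/-! ### The implications between the three conditions. -/

section Equivalence

variable {n d : ℕ} {v : Fin d → Fin n} {f : MvPolynomial (Fin n) ℝ}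

theorem pderiv_ne_zero_of_coeff_ne_zero (hv : Function.Injective v) (hhom : f.IsHomogeneous d)
    (haff : ∀ a, degreeOf (v a) f ≤ 1) (hcoeff : f.coeff (∑ a, Finsupp.single (v a) 1) ≠ 0)
    (a : Fin d) : pderiv (v a) f ≠ 0 := by
  intro h
  have := eval_pderiv_base hv hhom haff a
  rw [h, map_zero] at this
  exact hcoeff this.symm

theorem isSquare_mk_of_isSquare_wronskianDelta {i j : Fin n}
    (h : IsSquare (wronskianDelta i j f)) :
    IsSquare (Ideal.Quotient.mk (Ideal.span {f}) (pderiv i f * pderiv j f)) := by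
  obtain ⟨g, hg⟩ := h
  refine ⟨Ideal.Quotient.mk _ g, ?_⟩
  rw [← map_mul, ← hg, Ideal.Quotient.eq, Ideal.mem_span_singleton]
  exact ⟨pderiv i (pderiv j f), by rw [wronskianDelta]; ring⟩

theorem linearPencil_smul (s : ℝ) (M : Fin n → Matrix (Fin d) (Fin d) ℝ) :
    linearPencil (fun k => s • M k) = (C s : MvPolynomial (Fin n) ℝ) • linearPencil M := by
  refine Matrix.ext fun i j => ?_
  rw [Matrix.smul_apply, linearPencil_apply, linearPencil_apply, smul_eq_mul, Finset.mul_sum]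
  refine Finset.sum_congr rfl fun k _ => ?_
  rw [Matrix.smul_apply, smul_eq_mul, C_mul]
  ring

theorem hasDefiniteDetRep_of_isSquare (hd : 1 ≤ d) (hv : Function.Injective v)
    (hhom : f.IsHomogeneous d) (haff : ∀ a, degreeOf (v a) f ≤ 1)
    (hpos : 0 < f.coeff (∑ a, Finsupp.single (v a) 1))
    (hsq : ∀ i j, IsSquare (wronskianDelta (v i) (v j) f)) : HasDefiniteDetRep d f := by
  obtain ⟨M, hM, hMu, hf⟩ := exists_linearPencil_of_isSquare hv hhom haff rfl hpos.ne' hsq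
  set c := f.coeff (∑ a, Finsupp.single (v a) 1)
  -- Scaling all M_k by the d-th root of c multiplies the determinant by c.
  have hs : (c ^ (d : ℝ)⁻¹) ^ d = c := Real.rpow_inv_natCast_pow hpos.le (by lia)
  refine ⟨fun k => c ^ (d : ℝ)⁻¹ • M k, fun k => (hM k).smul _,
    ⟨∑ a, Pi.single (v a) 1, ?_⟩, ?_⟩
  · simp only [smul_comm _ (c ^ (d : ℝ)⁻¹)]
    rw [← Finset.smul_sum, hMu]
    exact Matrix.PosDef.one.smul (Real.rpow_pos_of_pos hpos _)
  · rw [linearPencil_smul, Matrix.det_smul, Fintype.card_fin, ← C_pow, hs]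
    exact hf

theorem isSquare_wronskianDelta_of_hasDefiniteDetRep (hv : Function.Injective v)
    (hhom : f.IsHomogeneous d) (hf : IsStable (f.map (algebraMap ℝ ℂ)))
    (haff : ∀ a, degreeOf (v a) f ≤ 1) (hcoeff : f.coeff (∑ a, Finsupp.single (v a) 1) ≠ 0)
    (hrep : HasDefiniteDetRep d f) (i j : Fin d) : IsSquare (wronskianDelta (v i) (v j) f) := by
  have hD2 : ∀ a, pderiv (v a) (pderiv (v a) f) = 0 := fun a => pderiv_pderiv_self_eq_zero (haff a)
  rcases eq_or_ne i j with rfl | hij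
  · exact ⟨pderiv (v i) f, by rw [wronskianDelta, hD2, mul_zero, sub_zero]⟩
  obtain ⟨M, hM, ⟨e, he⟩, hdet⟩ := hrep
  have hrank : ∀ a, ∃ (l : ℝ) (w : Fin d → ℝ), M (v a) = l • Matrix.vecMulVec w w := by
    intro a
    refine he.exists_eq_smul_vecMulVec (hM (v a))
      (Polynomial.C (eval e (pderiv (v a) f)) * Polynomial.X + Polynomial.C (eval e f))
      Polynomial.natDegree_linear_le fun t => ?_
    have h1 := eval_add_single (hD2 a) e t
    have h2 : ∑ k, (e + t • Pi.single (v a) 1 : Fin n → ℝ) k • M k =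
        ∑ k, e k • M k + t • M (v a) := by
      simp only [Pi.add_apply, add_smul, Finset.sum_add_distrib, Pi.smul_apply, smul_eq_mul]
      congr 1
      rw [Finset.sum_eq_single (v a)]
      · simp
      · intro k _ hk
        simp [Pi.single_eq_of_ne hk]
      · simp
    rw [← h2, ← eval_det_linearPencil, ← hdet, h1]
    simp
    ring
  obtain ⟨a, w, hi⟩ := hrank i
  obtain ⟨b, w', hj⟩ := hrank j
  obtain ⟨g, hg⟩ := wronskianDelta_det_linearPencil hM hi hj
  rw [← hdet] at hg
  rcases le_or_gt 0 (a * b) with hab | hab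
  · refine ⟨C (Real.sqrt (a * b)) * g, ?_⟩
    rw [hg, mul_mul_mul_comm, ← C_mul, Real.mul_self_sqrt hab, sq]
  -- If g ≠ 0, some point has both g and ∂_i∂_j f nonzero; there Δ_ij f = ab g² < 0 contradicts
  -- stability.
  · have hg0 : g = 0 := by
      by_contra hg0
      have hdd : pderiv (v i) (pderiv (v j) f) ≠ 0 := fun h => by
        have := eval_pderiv_pderiv_base hv hhom haff hij
        rw [h, map_zero] at this
        exact hcoeff this.symm
      obtain ⟨x, hx⟩ : ∃ x, eval x (pderiv (v i) (pderiv (v j) f) * g) ≠ 0 := by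
        by_contra h
        push Not at h
        exact mul_ne_zero hdd hg0 (MvPolynomial.funext fun x => by rw [h x, map_zero])
      rw [map_mul] at hx
      have h1 := hf.eval_wronskianDelta_nonneg (hD2 i) (hD2 j) x (left_ne_zero_of_mul hx)
      rw [hg, map_mul, eval_C, map_pow] at h1
      have h2 : 0 < eval x g ^ 2 := by
        have := right_ne_zero_of_mul hx
        positivity
      exact absurd h1 (not_le.mpr (mul_neg_of_neg_of_pos hab h2))
    exact ⟨0, by rw [hg, hg0]; ring⟩

end Equivalence

theorem theorem5p5 (n d : ℕ) (hd : 1 ≤ d) (hdn : d ≤ n)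
    (f : MvPolynomial (Fin n) ℝ)
    (hhom : f.IsHomogeneous d)
    (hstable : IsStable (f.map (algebraMap ℝ ℂ)))
    (hpos : ∃ e : Fin n → ℝ, (∀ i, 0 < e i) ∧ 0 < MvPolynomial.eval e f)
    (haff : ∀ i : Fin d, IsAffineIn f (Fin.castLE hdn i))
    (hcoeff : f.coeff (∑ i : Fin d, Finsupp.single (Fin.castLE hdn i) 1) ≠ 0) :
    List.TFAE [
      ∀ i j : Fin d, IsSquare (wronskianDelta (Fin.castLE hdn i) (Fin.castLE hdn j) f),
      ∀ i j : Fin d, IsSquare (Ideal.Quotient.mk (Ideal.span {f})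
        (MvPolynomial.pderiv (Fin.castLE hdn i) f * MvPolynomial.pderiv (Fin.castLE hdn j) f)),
      HasDefiniteDetRep d f] := by
  have hv : Function.Injective (Fin.castLE hdn) := Fin.castLE_injective hdn
  have haff' : ∀ i : Fin d, degreeOf (Fin.castLE hdn i) f ≤ 1 := haff
  tfae_have 1 → 2 := fun h i j => isSquare_mk_of_isSquare_wronskianDelta (h i j)
  tfae_have 2 → 1 := fun h i j => isSquare_wronskianDelta_of_isSquare_mk
    (pderiv_pderiv_self_eq_zero (haff' i))
    (pderiv_ne_zero_of_coeff_ne_zero hv hhom haff' hcoeff i) (h i j)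
  tfae_have 1 → 3 := fun h => by
    obtain ⟨e, he, hfe⟩ := hpos
    refine hasDefiniteDetRep_of_isSquare hd hv hhom haff' (lt_of_le_of_ne ?_ hcoeff.symm) h
    rw [← eval_base hv hhom haff']
    refine hstable.eval_nonneg_of_nonneg hhom he hfe fun k => ?_
    rw [Finset.sum_apply]
    refine Finset.sum_nonneg fun a _ => ?_
    rw [Pi.single_apply]
    split_ifs <;> norm_num
  tfae_have 3 → 1 := isSquare_wronskianDelta_of_hasDefiniteDetRep hv hhom hstable haff' hcoeff
  tfae_finish
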